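/- Let $r\ge 1$ and $n\ge 0$ be integers, and let $Z_n=\mathbb{C}^{2n}/G_n$ be the quotient of $\mathbb{C}^{2n}=(\mathbb{C}^2)^n$ by $G_n=(\mathbb{Z}/r\mathbb{Z})\wr S_n$, where a generator of the $i$-th copy of $\mathbb{Z}/r\mathbb{Z}$ acts on the $i$-th plane by $(X_i,Y_i)\mapsto(\zeta X_i,\zeta^{-1}Y_i)$ with $\zeta=e^{2\pi\sqrt{-1}/r}$, and $S_n$ permutes the $n$ planes. Thus $\mathbb{C}[Z_n]=\mathbb{C}[X_1,\dots,X_n,Y_1,\dots,Y_n]^{G_n}$. Let $\mathbb{T}=\mathbb{C}^*$ act on $Z_n$ through $(X_i,Y_i)\mapsto(tX_i,t^{-1}Y_i)$ and $\mathbb{S}=\mathbb{C}^*$ through $(X_i,Y_i)\mapsto(sX_i,sY_i)$. Let $Z_n^{\mathbb{T}}$ be the scheme of $\mathbb{T}$-fixed points, so that $\mathbb{C}[Z_n^{\mathbb{T}}]=\mathbb{C}[Z_n]/J_n$, where $J_n$ is the ideal generated by all $t\cdot f-f$ with $t\in\mathbb{T}$, $f\in\mathbb{C}[Z_n]$; it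 is graded by the weights of $\mathbb{S}$. Put $x_i=X_i^r$, $y_i=Y_i^r$, $z_i=X_iY_i$. For a finite multiset $\Lambda=(a_1,b_1,c_1)\cdots(a_l,b_l,c_l)$ of nonzero triples of non-negative integers, let $m_\Lambda\in\mathbb{C}[Z_n]$ be the image of the sum of the distinct monomials in the $S_n$-orbit of $x_1^{a_1}y_1^{b_1}z_1^{c_1}\cdots x_l^{a_l}y_l^{b_l}z_l^{c_l}$ (and $m_\Lambda=0$ if $l>n$), and let $\bar m_\Lambda$ be its class in $\mathbb{C}[Z_n^{\mathbb{T}}]$. Let $\lambda=(\lambda_0,\dots,\lambda_{r-1})$ run over the $r$-tuples of finite multisets of non-negative integers such that $0$ is not a part of $\lambda_0$ (parts equal to $0$ are allowed in $\lambda_i$ for $i\ge1$). Write $|\lambda_i|$ for the sum and $l(\lambda_i)$ for the number of parts of $\lambda_i$ (zero parts included), $|\lambda|=\sum_i|\lambda_i|$ and $l(\lambda)=\sum_i l(\lambda_i)$. Let $(\lambda_0,\dots,\lambda_{r-1})(0,1,0)^{|\lambda|}$ be the multiset consisting of the triples $(p,0,i)$, one for each part $p$ of each $\lambda_i$, together with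 $|\lambda|$ copies of $(0,1,0)$. Then the elements $\bar m_{(\lambda_0,\dots,\lambda_{r-1})(0,1,0)^{|\lambda|}}$ with $|\lambda|+l(\lambda)\le n$ form a basis of the $\mathbb{C}$-vector space $\mathbb{C}[Z_n^{\mathbb{T}}]$. The element indexed by $\lambda$ is homogeneous of degree $2\sum_i\bigl(r|\lambda_i|+i\,l(\lambda_i)\bigr)$. Consequently the finite-dimensional space $\mathbb{C}[Z_n^{\mathbb{T}}]$ is the direct sum of its components of degree $k\ge0$, its components of odd degree vanish, and for every $k\ge 0$ the dimension of its component of degree $2k$ is the number of such $\lambda$ with $|\lambda|+l(\lambda)\le n$ and $\sum_i\bigl(r|\lambda_i|+i\,l(\lambda_i)\bigr)=k$. -/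

import Mathlib

open MvPolynomial

noncomputable section

namespace WreathFixed

/-- The coordinate ring `ℂ[X_1, …, X_n, Y_1, …, Y_n]` of `ℂ^{2n}`, where `X_i = X (Sum.inl i)` and
`Y_i = X (Sum.inr i)`. -/
abbrev Poly (n : ℕ) : Type := MvPolynomial (Fin n ⊕ Fin n) ℂ

/-- The wreath product `(ℤ/rℤ) ≀ S_n = (ℤ/rℤ)^n ⋊ S_n`, with the cyclic group `ℤ/rℤ` realised as the
group of complex `r`-th roots of unity and `S_n` permuting the factors. -/
abbrev Wreath (r n : ℕ) : Type :=
  (Fin n → rootsOfUnity r ℂ) ⋊[mulAutArrow] Equiv.Perm (Fin n)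

/-- The substitution `X_i ↦ ζ_{σ i}⁻¹ X_{σ i}`, `Y_i ↦ ζ_{σ i} Y_{σ i}` attached to `g = (ζ, σ)`. -/
def wreathHom (r n : ℕ) (g : Wreath r n) : Poly n →ₐ[ℂ] Poly n :=
  aeval (Sum.elim
    (fun i => C (((g.left (g.right i))⁻¹ : rootsOfUnity r ℂ) : ℂˣ).val * X (Sum.inl (g.right i)))
    (fun i => C ((g.left (g.right i) : rootsOfUnity r ℂ) : ℂˣ).val * X (Sum.inr (g.right i))))

theorem wreathHom_inl (r n : ℕ) (g : Wreath r n) (i : Fin n) :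
    wreathHom r n g (X (Sum.inl i)) =
      C (((g.left (g.right i))⁻¹ : rootsOfUnity r ℂ) : ℂˣ).val * X (Sum.inl (g.right i)) := by
  simp [wreathHom]

theorem wreathHom_inr (r n : ℕ) (g : Wreath r n) (i : Fin n) :
    wreathHom r n g (X (Sum.inr i)) =
      C ((g.left (g.right i) : rootsOfUnity r ℂ) : ℂˣ).val * X (Sum.inr (g.right i)) := by
  simp [wreathHom]

/-- The action of the wreath product on polynomial functions, `(g • f)(p) = f(g⁻¹ p)`, where
`g = (ζ, σ)` acts on `ℂ^{2n} = (ℂ²)^n` by letting `ζ_i` act on the `i`-th plane by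
`(X, Y) ↦ (ζ_i X, ζ_i⁻¹ Y)` and `σ` permute the `n` planes. -/
def wreathAct (r n : ℕ) : Wreath r n →* (Poly n →ₐ[ℂ] Poly n) where
  toFun := wreathHom r n
  map_one' := by
    apply MvPolynomial.algHom_ext
    rintro (i | i) <;> simp [wreathHom]
  map_mul' g h := by
    have hs : ∀ i, (mulAutArrow g.right : MulAut (Fin n → rootsOfUnity r ℂ)) h.left
        (g.right (h.right i)) = h.left (h.right i) := fun i =>
      congrArg h.left (g.right.symm_apply_apply (h.right i))
    apply MvPolynomial.algHom_ext
    rintro (i | i)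
    · simp [wreathHom, AlgHom.mul_apply, hs, -mulAutArrow_apply_apply]
      ring
    · simp [wreathHom, AlgHom.mul_apply, hs, -mulAutArrow_apply_apply]
      ring

/-- The coordinate ring `ℂ[Z_n] = ℂ[X_1, …, X_n, Y_1, …, Y_n]^{G_n}` of the quotient
`Z_n = ℂ^{2n} / G_n`, where `G_n = (ℤ/rℤ) ≀ S_n`. -/
def quotRing (r n : ℕ) : Subalgebra ℂ (Poly n) where
  carrier := {f | ∀ g : Wreath r n, wreathAct r n g f = f}
  mul_mem' ha hb g := by rw [map_mul, ha g, hb g]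
  add_mem' ha hb g := by rw [map_add, ha g, hb g]
  algebraMap_mem' c g := AlgHom.commutes _ c

/-- The pullback of functions along `(X_i, Y_i) ↦ (α X_i, β Y_i)` on `ℂ^{2n}`. -/
def scale (n : ℕ) (α β : ℂ) : Poly n →ₐ[ℂ] Poly n :=
  aeval (Sum.elim (fun i => C α * X (Sum.inl i)) (fun i => C β * X (Sum.inr i)))

theorem wreathAct_scale (r n : ℕ) (α β : ℂ) (g : Wreath r n) (f : Poly n) :
    wreathAct r n g (scale n α β f) = scale n α β (wreathAct r n g f) := by
  have h : (wreathAct r n g).comp (scale n α β) = (scale n α β).comp (wreathAct r n g) := by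
    apply MvPolynomial.algHom_ext
    rintro (i | i) <;> simp [wreathAct, wreathHom, scale] <;> ring
  exact DFunLike.congr_fun h f

/-- The pullback along `(X_i, Y_i) ↦ (α X_i, β Y_i)` on `ℂ[Z_n]`. -/
def scaleQuot (r n : ℕ) (α β : ℂ) : quotRing r n →ₐ[ℂ] quotRing r n :=
  ((scale n α β).comp (quotRing r n).val).codRestrict (quotRing r n) fun f g => by
    have hf := f.2 g
    simp only [AlgHom.comp_apply, Subalgebra.coe_val, wreathAct_scale, hf]

/-- The action of `t ∈ 𝕋 = ℂˣ` on `ℂ[Z_n]`, induced by `(X_i, Y_i) ↦ (t X_i, t⁻¹ Y_i)`. -/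
def torusAct (r n : ℕ) (t : ℂˣ) : quotRing r n →ₐ[ℂ] quotRing r n :=
  scaleQuot r n (t : ℂ) ((t⁻¹ : ℂˣ) : ℂ)

/-- The action of `s ∈ 𝕊 = ℂˣ` on `ℂ[Z_n]`, induced by `(X_i, Y_i) ↦ (s X_i, s Y_i)`. -/
def conicalAct (r n : ℕ) (s : ℂˣ) : quotRing r n →ₐ[ℂ] quotRing r n :=
  scaleQuot r n (s : ℂ) (s : ℂ)

/-- The ideal of `ℂ[Z_n]` that defines the scheme of `𝕋`-fixed points of `Z_n`: it is generated by
all `t · f - f`. -/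
def fixedIdeal (r n : ℕ) : Ideal (quotRing r n) :=
  Ideal.span {h | ∃ (t : ℂˣ) (f : quotRing r n), h = torusAct r n t f - f}

/-- The coordinate ring `ℂ[Z_n^𝕋]` of the scheme of `𝕋`-fixed points. -/
abbrev FixedRing (r n : ℕ) : Type := quotRing r n ⧸ fixedIdeal r n

theorem scale_comm (n : ℕ) (α β γ δ : ℂ) (f : Poly n) :
    scale n α β (scale n γ δ f) = scale n γ δ (scale n α β f) := by
  have h : (scale n α β).comp (scale n γ δ) = (scale n γ δ).comp (scale n α β) := by
    apply MvPolynomial.algHom_ext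
    rintro (i | i) <;> simp [scale] <;> ring
  exact DFunLike.congr_fun h f

theorem conicalAct_torusAct (r n : ℕ) (s t : ℂˣ) (f : quotRing r n) :
    conicalAct r n s (torusAct r n t f) = torusAct r n t (conicalAct r n s f) :=
  Subtype.ext (scale_comm n _ _ _ _ f.1)

theorem fixedIdeal_le_comap (r n : ℕ) (s : ℂˣ) :
    fixedIdeal r n ≤ (fixedIdeal r n).comap (conicalAct r n s) := by
  refine Ideal.span_le.2 ?_
  rintro _ ⟨t, f, rfl⟩
  refine Ideal.subset_span ⟨t, conicalAct r n s f, ?_⟩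
  rw [map_sub, conicalAct_torusAct]

/-- The action of `s ∈ 𝕊 = ℂˣ` on `ℂ[Z_n^𝕋]`. -/
def conicalActFixed (r n : ℕ) (s : ℂˣ) : FixedRing r n →ₐ[ℂ] FixedRing r n :=
  Ideal.quotientMapₐ (fixedIdeal r n) (conicalAct r n s) (fixedIdeal_le_comap r n s)

/-- The component of degree `k` of `ℂ[Z_n^𝕋]`: the weight space of weight `k` for `𝕊`. -/
def gradedPart (r n k : ℕ) : Submodule ℂ (FixedRing r n) where
  carrier := {f | ∀ s : ℂˣ, conicalActFixed r n s f = (s : ℂ) ^ k • f}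
  zero_mem' s := by simp
  add_mem' ha hb s := by rw [map_add, ha s, hb s, smul_add]
  smul_mem' c f hf s := by rw [map_smul, hf s, smul_comm]

/-- The ring `R_n = ℂ[x_1, …, x_n, y_1, …, y_n, z_1, …, z_n]`; the variables `x_i`, `y_i`, `z_i` are
`X (i, 0)`, `X (i, 1)`, `X (i, 2)`. -/
abbrev TriPoly (n : ℕ) : Type := MvPolynomial (Fin n × Fin 3) ℂ

/-- The exponent vectors `e = (a_i, b_i, c_i)_i` of the monomials in the `S_n`-orbit of
`x_1^{a_1} y_1^{b_1} z_1^{c_1} ⋯ x_l^{a_l} y_l^{b_l} z_l^{c_l}`, for the multiset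
`Λ = (a_1, b_1, c_1) ⋯ (a_l, b_l, c_l)` of nonzero triples. There are none if `l > n`. -/
def orbitExponents (n : ℕ) (Λ : Multiset (ℕ × ℕ × ℕ)) : Finset (Fin n → ℕ × ℕ × ℕ) :=
  (Fintype.piFinset fun _ => insert 0 Λ.toFinset).filter
    fun e => (Finset.univ.val.map e).filter (fun v => v ≠ 0) = Λ

/-- The monomial symmetric function `m_Λ` in `R_n`: the sum of the distinct monomials in the
`S_n`-orbit of `x_1^{a_1} y_1^{b_1} z_1^{c_1} ⋯ x_l^{a_l} y_l^{b_l} z_l^{c_l}`. -/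
def monoSymm (n : ℕ) (Λ : Multiset (ℕ × ℕ × ℕ)) : TriPoly n :=
  ∑ e ∈ orbitExponents n Λ,
    ∏ i, X (i, 0) ^ (e i).1 * X (i, 1) ^ (e i).2.1 * X (i, 2) ^ (e i).2.2

/-- The substitution `x_i ↦ X_i^r`, `y_i ↦ Y_i^r`, `z_i ↦ X_i Y_i`, which induces the isomorphism
`(R_n / (x_i y_i - z_i^r))^{S_n} ≃ ℂ[Z_n]`. -/
def triSubst (r n : ℕ) : TriPoly n →ₐ[ℂ] Poly n :=
  aeval fun v => ![X (Sum.inl v.1) ^ r, X (Sum.inr v.1) ^ r,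
    X (Sum.inl v.1) * X (Sum.inr v.1)] v.2

theorem orbitExponents_comp (n : ℕ) (Λ : Multiset (ℕ × ℕ × ℕ)) (σ : Equiv.Perm (Fin n))
    (e : Fin n → ℕ × ℕ × ℕ) : e ∘ σ ∈ orbitExponents n Λ ↔ e ∈ orbitExponents n Λ := by
  have h1 : Finset.univ.val.map (e ∘ σ) = Finset.univ.val.map e := by
    rw [← Multiset.map_map]
    congr 1
    exact Multiset.map_univ_val_equiv σ
  have h2 : (∀ i, (e ∘ σ) i ∈ insert 0 Λ.toFinset) ↔ ∀ i, e i ∈ insert 0 Λ.toFinset :=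
    ⟨fun h i => by simpa using h (σ.symm i), fun h i => h (σ i)⟩
  simp only [orbitExponents, Finset.mem_filter, Fintype.mem_piFinset, h1, h2]

theorem wreathAct_triSubst_X (r n : ℕ) (g : Wreath r n) (i : Fin n) (j : Fin 3) :
    wreathAct r n g (triSubst r n (X (i, j))) = triSubst r n (X (g.right i, j)) := by
  have hz : (((g.left (g.right i) : rootsOfUnity r ℂ) : ℂˣ) : ℂ) ^ r = 1 := by
    have := (g.left (g.right i)).2
    rw [mem_rootsOfUnity'] at this
    exact this
  have hx := wreathHom_inl r n g i
  have hy := wreathHom_inr r n g i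
  change wreathHom r n g _ = _
  fin_cases j
  · simp only [triSubst, aeval_X, Fin.zero_eta, Matrix.cons_val_zero, map_pow, hx, mul_pow]
    rw [← C_pow, ← Units.val_pow_eq_pow_val, ← Subgroup.coe_pow, inv_pow]
    have : g.left (g.right i) ^ r = 1 := by
      ext
      simpa using hz
    simp [this]
  · simp [triSubst, hy, mul_pow, ← C_pow, hz]
  · simp only [triSubst, aeval_X, Fin.reduceFinMk, Matrix.cons_val, map_mul, hx, hy]
    rw [mul_mul_mul_comm, ← C_mul, ← Units.val_mul, ← Subgroup.coe_mul, inv_mul_cancel]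
    simp

theorem triSubst_monoSymm_mem (r n : ℕ) (Λ : Multiset (ℕ × ℕ × ℕ)) :
    triSubst r n (monoSymm n Λ) ∈ quotRing r n := by
  intro g
  simp only [monoSymm, map_sum, map_prod, map_mul, map_pow, wreathAct_triSubst_X]
  refine Finset.sum_equiv (Equiv.arrowCongr g.right (Equiv.refl _)) (fun e => ?_) (fun e _ => ?_)
  · exact (orbitExponents_comp n Λ g.right.symm e).symm
  · exact Fintype.prod_equiv g.right _ _ fun i => by simp

/-- The class of `m_Λ` in `ℂ[Z_n^𝕋]`. -/
def monoSymmBar (r n : ℕ) (Λ : Multiset (ℕ × ℕ × ℕ)) : FixedRing r n :=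
  Ideal.Quotient.mk (fixedIdeal r n) ⟨triSubst r n (monoSymm n Λ), triSubst_monoSymm_mem r n Λ⟩

/-- The total size `|λ| = ∑ |λ_i|`. -/
def size {r : ℕ} (lam : Fin r → Multiset ℕ) : ℕ := ∑ i, (lam i).sum

/-- The total length `l(λ) = ∑ l(λ_i)`; all parts are counted, parts equal to `0` included. -/
def len {r : ℕ} (lam : Fin r → Multiset ℕ) : ℕ := ∑ i, (lam i).card

/-- The number `∑ (r |λ_i| + i l(λ_i))`. -/
def halfDegree {r : ℕ} (lam : Fin r → Multiset ℕ) : ℕ :=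
  ∑ i, (r * (lam i).sum + (i : ℕ) * (lam i).card)

/-- The tripartition `(λ_0, …, λ_{r-1}) (0,1,0)^{|λ|}`, where `(λ_0, …, λ_{r-1})` is the product of
the triples `(p, 0, i)`, for `p` a part of `λ_i`. -/
def toTri {r : ℕ} (lam : Fin r → Multiset ℕ) : Multiset (ℕ × ℕ × ℕ) :=
  (∑ i : Fin r, (lam i).map fun p => (p, 0, (i : ℕ))) + Multiset.replicate (size lam) (0, 1, 0)

/-- The `r`-tuples `λ = (λ_0, …, λ_{r-1})` of partitions with `|λ| + l(λ) ≤ n`. A part `p` of `λ_i`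
stands for the triple `(p, 0, i)`, which has to be different from `(0, 0, 0)`: parts equal to `0` are
excluded from `λ_0` and allowed in `λ_i` for `i ≥ 1`. -/
def Index (r n : ℕ) : Type :=
  {lam : Fin r → Multiset ℕ // (∀ i : Fin r, (i : ℕ) = 0 → 0 ∉ lam i) ∧ size lam + len lam ≤ n}

end WreathFixed

end

namespace WreathFixed

/-! Independence. A part `p` of `λ_i` is modelled by a cluster of `p + 1` points `(η^j s, η^(-j)
t)`, `0 ≤ j ≤ p`, with `η` a primitive `r(p+1)`-th root of unity and `s`, `t` free. The clusters of
`λ` use `|λ| + l(λ) ≤ n` points. Replacing `(s, t)` by `(η s, η⁻¹ t)` moves a cluster by an element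
of `G_n`, so a restricted invariant only has monomials whose exponents in `s` and `t` agree mod
`r(p+1)`. For exponents below `r(p+1)` this means equality, hence `𝕋`-weight zero, so `J_n` has no
coefficient in that box and every such coefficient is a functional on `ℂ[Z_n^𝕋]`
(`coeff_clusterHom_fixedIdeal`). The coefficient of the product of the `(s t)^(rp+i)` kills `m_μ`
for `|μ| ≥ |λ|`, `μ ≠ λ`, and not `m_λ`, since balance allows at most `p` factors `y` on a cluster
(`cluster_balanced`). So the system is triangular with respect to `|λ|`.

Spanning. Orbit sums of monomials span `ℂ[Z_n]`. Work modulo monomials living on fewer planes. A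
monomial with different exponents of `X_i` and `Y_i` on some plane vanishes, by a power sum of
nonzero `𝕋`-weight (`orbitSumBar_mem_of_unbalanced`). A balanced monomial `∏ (X_i Y_i)^(a_i)` is
traded, through the elementary symmetric functions of the `y_i`, which lie in `J_n`, for one with
the surplus `y`'s on distinct fresh planes (`straighten`). This is a multiple of an `m_λ` of the
required shape. -/

theorem coeff_aeval_C_mul_X {σ : Type*} (u : σ → ℂ) (f : MvPolynomial σ ℂ) (m : σ →₀ ℕ) :
    coeff m (aeval (fun v => C (u v) * X v) f) = (m.prod fun v k => u v ^ k) * coeff m f := by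
  classical
  induction f using MvPolynomial.induction_on' with
  | monomial m' a =>
    have h : aeval (fun v => C (u v) * X v) (monomial m' a) =
        monomial m' (a * m'.prod fun v k => u v ^ k) := by
      rw [aeval_monomial, monomial_eq, C_mul, Finsupp.prod, Finsupp.prod, Finsupp.prod, map_prod]
      simp only [mul_pow, Finset.prod_mul_distrib, C_pow, algebraMap_eq, mul_assoc]
    rw [h, coeff_monomial, coeff_monomial]
    split_ifs with h'
    · subst h'; ring
    · simp
  | add p q hp hq => rw [map_add, coeff_add, coeff_add, hp, hq, mul_add]

/-! ### Restriction of invariants to cluster configurations -/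

section Cluster

variable {n : ℕ} {κ : Type*}

/-- The restriction of functions to the family of configurations whose `i`-th point is
`(v_i s_c, v_i⁻¹ t_c)`, where `c = cl i` and the `s_c`, `t_c` are free parameters. -/
noncomputable def clusterHom (cl : Fin n → κ) (v : Fin n → ℂˣ) :
    Poly n →ₐ[ℂ] MvPolynomial (κ ⊕ κ) ℂ :=
  aeval (Sum.elim (fun i => C (v i : ℂ) * X (Sum.inl (cl i)))
    (fun i => C (((v i)⁻¹ : ℂˣ) : ℂ) * X (Sum.inr (cl i))))

/-- On the parameters, `t ∈ 𝕋` scales every `s_c` by `t` and every `t_c` by `t⁻¹`, and a balanced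
monomial has weight zero. -/
theorem clusterHom_scale [Fintype κ] (cl : Fin n → κ) (v : Fin n → ℂˣ) (t : ℂˣ) (f : Poly n)
    (m : κ ⊕ κ →₀ ℕ) (hm : ∀ c, m (Sum.inl c) = m (Sum.inr c)) :
    coeff m (clusterHom cl v (scale n t ((t⁻¹ : ℂˣ) : ℂ) f)) = coeff m (clusterHom cl v f) := by
  let u : κ ⊕ κ → ℂ := Sum.elim (fun _ => (t : ℂ)) (fun _ => ((t⁻¹ : ℂˣ) : ℂ))
  have h : (clusterHom cl v).comp (scale n t ((t⁻¹ : ℂˣ) : ℂ)) =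
      (aeval (fun w => C (u w) * X w)).comp (clusterHom cl v) := by
    apply MvPolynomial.algHom_ext
    rintro (i | i) <;> simp [clusterHom, scale, u] <;> ring
  have h2 := DFunLike.congr_fun h f
  simp only [AlgHom.comp_apply] at h2
  rw [h2, coeff_aeval_C_mul_X, Finsupp.prod_fintype _ _ (by simp), Fintype.prod_sum_type,
    ← Finset.prod_mul_distrib, Finset.prod_eq_one, one_mul]
  intro c _
  simp only [u, Sum.elim_inl, Sum.elim_inr, hm c]
  rw [← mul_pow, ← Units.val_mul]
  simp

/-- The hypotheses on `g` say that it realises `(s_c, t_c) ↦ (ζ s_c, ζ⁻¹ t_c)` with the other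
parameters fixed; comparing coefficients of an invariant on both sides gives the congruence. -/
theorem clusterHom_balanced [Fintype κ] [DecidableEq κ] {r : ℕ} (cl : Fin n → κ)
    (v : Fin n → ℂˣ) (c : κ) (ζ : ℂˣ) (g : Wreath r n) (hcl : ∀ i, cl (g.right i) = cl i)
    (hg : ∀ i, ((g.left (g.right i) : ℂˣ))⁻¹ * v (g.right i) = (if cl i = c then ζ else 1) * v i)
    {f : Poly n} (hf : f ∈ quotRing r n) (m : κ ⊕ κ →₀ ℕ)
    (hm : coeff m (clusterHom cl v f) ≠ 0) : ζ ^ m (Sum.inl c) = ζ ^ m (Sum.inr c) := by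
  let u : κ ⊕ κ → ℂˣ := Sum.elim (fun c' => if c' = c then ζ else 1)
    (fun c' => if c' = c then ζ⁻¹ else 1)
  have h : (clusterHom cl v).comp (wreathAct r n g) =
      (aeval (fun w => C (u w : ℂ) * X w)).comp (clusterHom cl v) := by
    apply MvPolynomial.algHom_ext
    rintro (i | i)
    · have hx := wreathHom_inl r n g i
      change clusterHom cl v (wreathHom r n g _) = _
      rw [hx]
      simp only [clusterHom, map_mul, aeval_X, Sum.elim_inl, AlgHom.comp_apply, hcl, algHom_C,
        algebraMap_eq, u]
      rw [← mul_assoc, ← mul_assoc, ← C_mul, ← C_mul, mul_comm (v i : ℂ)]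
      have := congrArg (Units.val) (hg i)
      simp only [Units.val_mul] at this
      rw [← this]
      simp
    · have hx := wreathHom_inr r n g i
      change clusterHom cl v (wreathHom r n g _) = _
      rw [hx]
      simp only [clusterHom, map_mul, aeval_X, Sum.elim_inr, AlgHom.comp_apply, hcl, algHom_C,
        algebraMap_eq, u]
      rw [← mul_assoc, ← mul_assoc, ← C_mul, ← C_mul, mul_comm (((v i)⁻¹ : ℂˣ) : ℂ)]
      have := congrArg (fun x : ℂˣ => ((x⁻¹ : ℂˣ) : ℂ)) (hg i)
      simp only [mul_inv, inv_inv, Units.val_mul] at this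
      rw [this]
      split_ifs <;> simp
  have h2 := congrArg (coeff m) (DFunLike.congr_fun h f)
  simp only [AlgHom.comp_apply, hf g] at h2
  rw [coeff_aeval_C_mul_X, Finsupp.prod_fintype _ _ (by simp), Fintype.prod_sum_type] at h2
  have h3 := mul_right_cancel₀ hm ((one_mul _).trans h2)
  have h4 : ∀ a : κ ⊕ κ, (u a : ℂ) ^ m a = ((u a ^ m a : ℂˣ) : ℂ) := fun a => by simp
  simp only [h4, ← Units.coe_prod, ← Units.val_mul] at h3
  have h5 : (1 : ℂˣ) = _ := Units.ext (Units.val_one.trans h3)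
  simp only [u, Sum.elim_inl, Sum.elim_inr, ite_pow, one_pow, Finset.prod_ite_eq',
    Finset.mem_univ, if_true, inv_pow] at h5
  exact mul_inv_eq_one.1 h5.symm

/-- The polynomials without monomials whose exponents are all less than the given bounds. -/
noncomputable def boxIdeal {σ : Type*} (N : σ → ℕ) : Ideal (MvPolynomial σ ℂ) where
  carrier := {f | ∀ m : σ →₀ ℕ, (∀ v, m v < N v) → coeff m f = 0}
  zero_mem' m _ := coeff_zero m
  add_mem' ha hb m hm := by rw [coeff_add, ha m hm, hb m hm, add_zero]
  smul_mem' c f hf m hm := by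
    classical
    rw [smul_eq_mul, coeff_mul]
    refine Finset.sum_eq_zero fun x hx => ?_
    rw [Finset.HasAntidiagonal.mem_antidiagonal] at hx
    rw [hf x.2 fun v => ?_, mul_zero]
    refine lt_of_le_of_lt ?_ (hm v)
    rw [← hx]
    simp

/-- Inside the box, unbalanced coefficients vanish for `f` and for `t · f` alike, because powers of
a primitive root below its order are distinct; balanced ones agree. As the box condition defines an
ideal, checking the generators `t · f - f` suffices. -/
theorem coeff_clusterHom_fixedIdeal [Fintype κ] [DecidableEq κ] {r : ℕ} (cl : Fin n → κ)
    (v : Fin n → ℂˣ) (N : κ → ℕ)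
    (H : ∀ c, ∃ ζ : ℂˣ, IsPrimitiveRoot ζ (N c) ∧ ∃ g : Wreath r n,
      (∀ i, cl (g.right i) = cl i) ∧
      ∀ i, ((g.left (g.right i) : ℂˣ))⁻¹ * v (g.right i) = (if cl i = c then ζ else 1) * v i)
    (f : quotRing r n) (hf : f ∈ fixedIdeal r n) :
    clusterHom cl v f.1 ∈ boxIdeal (Sum.elim N N) := by
  have hle : fixedIdeal r n ≤ (boxIdeal (Sum.elim N N)).comap
      ((clusterHom cl v).comp (quotRing r n).val) := by
    refine Ideal.span_le.2 ?_
    rintro _ ⟨t, f, rfl⟩ m hm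
    have e : ((clusterHom cl v).comp (quotRing r n).val) (torusAct r n t f - f) =
        clusterHom cl v (scale n t ((t⁻¹ : ℂˣ) : ℂ) f.1) - clusterHom cl v f.1 :=
      map_sub (clusterHom cl v) _ _
    have hb : coeff m (clusterHom cl v f.1) ≠ 0 → ∀ c, m (Sum.inl c) = m (Sum.inr c) := by
      intro h0 c
      obtain ⟨ζ, hζ, g, h1, h2⟩ := H c
      exact hζ.pow_inj (hm (Sum.inl c)) (hm (Sum.inr c))
        (clusterHom_balanced cl v c ζ g h1 h2 f.2 m h0)
    have hb' : coeff m (clusterHom cl v (scale n t ((t⁻¹ : ℂˣ) : ℂ) f.1)) ≠ 0 →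
        ∀ c, m (Sum.inl c) = m (Sum.inr c) := by
      intro h0 c
      obtain ⟨ζ, hζ, g, h1, h2⟩ := H c
      exact hζ.pow_inj (hm (Sum.inl c)) (hm (Sum.inr c))
        (clusterHom_balanced cl v c ζ g h1 h2 (torusAct r n t f).2 m h0)
    change coeff m (((clusterHom cl v).comp (quotRing r n).val) (torusAct r n t f - f)) = 0
    rw [e, coeff_sub, sub_eq_zero]
    by_cases h : ∀ c, m (Sum.inl c) = m (Sum.inr c)
    · exact clusterHom_scale cl v t f.1 m h
    · rw [not_not.1 (mt hb' h), not_not.1 (mt hb h)]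
  exact hle hf

theorem coeff_clusterHom_prod [Fintype κ] [DecidableEq κ] (cl : Fin n → κ) (v : Fin n → ℂˣ)
    (A B : Fin n → ℕ) (d : κ ⊕ κ →₀ ℕ) :
    coeff d (clusterHom cl v (∏ i, X (Sum.inl i) ^ A i * X (Sum.inr i) ^ B i)) =
      if ∀ c, (∑ i, if cl i = c then A i else 0) = d (Sum.inl c) ∧
        (∑ i, if cl i = c then B i else 0) = d (Sum.inr c)
      then ((∏ i, v i ^ A i * (v i)⁻¹ ^ B i : ℂˣ) : ℂ) else 0 := by
  have h1 : clusterHom cl v (∏ i, X (Sum.inl i) ^ A i * X (Sum.inr i) ^ B i) =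
      C ((∏ i, v i ^ A i * (v i)⁻¹ ^ B i : ℂˣ) : ℂ) *
      monomial (∑ i, (Finsupp.single (Sum.inl (cl i)) (A i) +
        Finsupp.single (Sum.inr (cl i)) (B i))) 1 := by
    rw [monomial_sum_one, Units.coe_prod, map_prod, map_prod, ← Finset.prod_mul_distrib]
    refine Finset.prod_congr rfl fun i _ => ?_
    rw [← one_mul (1 : ℂ), ← monomial_mul, ← X_pow_eq_monomial, ← X_pow_eq_monomial]
    simp only [clusterHom, map_mul, map_pow, aeval_X, Sum.elim_inl, Sum.elim_inr, mul_pow,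
      Units.val_mul, Units.val_pow_eq_pow_val]
    ring
  rw [h1, coeff_C_mul, coeff_monomial, mul_ite, mul_one, mul_zero]
  refine if_congr ?_ rfl rfl
  rw [Finsupp.ext_iff]
  constructor
  · intro h c
    have h1 := h (Sum.inl c)
    have h2 := h (Sum.inr c)
    simp only [Finsupp.finsetSum_apply, Finsupp.add_apply, Finsupp.single_apply, Sum.inl.injEq,
      Sum.inr.injEq, reduceCtorEq, if_false, add_zero, zero_add] at h1 h2
    exact ⟨h1, h2⟩
  · rintro h (c | c)
    · simpa [Finsupp.finsetSum_apply, Finsupp.single_apply] using (h c).1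
    · simpa [Finsupp.finsetSum_apply, Finsupp.single_apply] using (h c).2

end Cluster

/-! ### Exponents of the monomials in `m_Λ` -/

theorem mem_orbitExponents {n : ℕ} {Λ : Multiset (ℕ × ℕ × ℕ)} {e : Fin n → ℕ × ℕ × ℕ} :
    e ∈ orbitExponents n Λ ↔ (Finset.univ.val.map e).filter (fun v => v ≠ 0) = Λ := by
  rw [orbitExponents, Finset.mem_filter, and_iff_right_iff_imp, Fintype.mem_piFinset]
  rintro rfl i
  by_cases h : e i = 0
  · simp [h]
  · simp [h]

theorem triSubst_monoSymm (r n : ℕ) (Λ : Multiset (ℕ × ℕ × ℕ)) :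
    triSubst r n (monoSymm n Λ) = ∑ e ∈ orbitExponents n Λ,
      ∏ i, X (Sum.inl i) ^ (r * (e i).1 + (e i).2.2) * X (Sum.inr i) ^ (r * (e i).2.1 + (e i).2.2) := by
  simp only [monoSymm, map_sum, map_prod, map_mul, map_pow]
  refine Finset.sum_congr rfl fun e _ => Finset.prod_congr rfl fun i _ => ?_
  simp only [triSubst, aeval_X, Matrix.cons_val]
  simp only [pow_add, pow_mul, mul_pow]
  ring

theorem mem_toTri {r : ℕ} {lam : Fin r → Multiset ℕ} {a : ℕ × ℕ × ℕ} (h : a ∈ toTri lam) :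
    a.2.1 = 0 ∨ a = (0, 1, 0) := by
  rw [toTri, Multiset.mem_add, Multiset.mem_sum] at h
  rcases h with ⟨i, -, h⟩ | h
  · obtain ⟨p, -, rfl⟩ := Multiset.mem_map.1 h
    exact Or.inl rfl
  · exact Or.inr (Multiset.eq_of_mem_replicate h)

theorem sum_map_toTri {r : ℕ} (lam : Fin r → Multiset ℕ) :
    ((toTri lam).map fun a => a.2.1).sum = size lam := by
  have h : ∀ s : Finset (Fin r), ((∑ i ∈ s, (lam i).map fun p => (p, 0, (i : ℕ))).map
      fun a : ℕ × ℕ × ℕ => a.2.1).sum = 0 := by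
    classical
    intro s
    induction s using Finset.induction_on with
    | empty => simp
    | insert a s ha ih => simp [Finset.sum_insert ha, ih]
  simp [toTri, h]

theorem sum_of_mem_orbitExponents {n : ℕ} {Λ : Multiset (ℕ × ℕ × ℕ)} {e : Fin n → ℕ × ℕ × ℕ}
    (he : e ∈ orbitExponents n Λ) (F : ℕ × ℕ × ℕ → ℕ) (hF : F 0 = 0) :
    ∑ i, F (e i) = (Λ.map F).sum := by
  rw [← mem_orbitExponents.1 he]
  have h : ∀ s : Multiset (ℕ × ℕ × ℕ), (s.map F).sum =
      ((s.filter fun v => v ≠ 0).map F).sum := by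
    intro s
    induction s using Multiset.induction_on with
    | empty => simp
    | cons a s ih =>
      by_cases h : a = 0
      · rw [Multiset.filter_cons_of_neg (p := fun v : ℕ × ℕ × ℕ => v ≠ 0) _ (not_not.2 h)]
        simp [h, ih, hF]
      · rw [Multiset.filter_cons_of_pos (p := fun v : ℕ × ℕ × ℕ => v ≠ 0) _ h]
        simp [ih]
  rw [← h, Multiset.map_map]
  rfl

theorem sum_snd_of_mem_orbitExponents {r n : ℕ} {lam : Fin r → Multiset ℕ}
    {e : Fin n → ℕ × ℕ × ℕ} (he : e ∈ orbitExponents n (toTri lam)) :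
    ∑ i, (e i).2.1 = size lam := by
  rw [← sum_map_toTri]
  exact sum_of_mem_orbitExponents he (fun a => a.2.1) rfl

theorem snd_zero_or_of_mem_orbitExponents {r n : ℕ} {lam : Fin r → Multiset ℕ}
    {e : Fin n → ℕ × ℕ × ℕ} (he : e ∈ orbitExponents n (toTri lam)) (i : Fin n) :
    (e i).2.1 = 0 ∨ e i = (0, 1, 0) := by
  by_cases h : e i = 0
  · exact Or.inl (by rw [h]; rfl)
  · refine mem_toTri (lam := lam) ?_
    rw [← mem_orbitExponents.1 he, Multiset.mem_filter]
    exact ⟨Multiset.mem_map_of_mem _ (Finset.mem_univ_val i), h⟩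

theorem count_toTri {r : ℕ} (lam : Fin r → Multiset ℕ) (i : Fin r) (p : ℕ) :
    (toTri lam).count (p, 0, (i : ℕ)) = (lam i).count p := by
  classical
  rw [toTri, Multiset.count_add, Multiset.count_replicate, if_neg (by simp), add_zero,
    Multiset.count_sum', Finset.sum_eq_single i]
  · exact Multiset.count_map_eq_count' (fun p => (p, 0, (i : ℕ))) _
      (fun a b h => by simpa using h) p
  · intro j _ hj
    rw [Multiset.count_eq_zero]
    simp only [Multiset.mem_map, Prod.mk.injEq, true_and, not_exists, not_and]
    intro x _ _ h
    exact hj (Fin.ext h)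
  · simp

theorem toTri_injective {r : ℕ} : Function.Injective (toTri (r := r)) := by
  intro lam mu h
  ext i p
  rw [← count_toTri, h, count_toTri]

/-- A cluster of `p + 1` points whose weights balance carries at most `p` functions `y`, and if
there are `p` of them, the remaining point carries `x^p z^i`. -/
theorem cluster_balanced {r p i : ℕ} (hr : 0 < r) (e : Fin (p + 1) → ℕ × ℕ × ℕ)
    (good : ∀ j, (e j).2.1 = 0 ∨ e j = (0, 1, 0))
    (hA : ∑ j, (r * (e j).1 + (e j).2.2) = r * p + i)
    (hB : ∑ j, (r * (e j).2.1 + (e j).2.2) = r * p + i) :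
    ∑ j, (e j).2.1 ≤ p ∧ (∑ j, (e j).2.1 = p →
      ∃ j0, e j0 = (p, 0, i) ∧ ∀ j, j ≠ j0 → e j = (0, 1, 0)) := by
  -- The `z`-exponents contribute equally to both weights and cancel.
  have hab : ∑ j, (e j).1 = ∑ j, (e j).2.1 := by
    rw [Finset.sum_add_distrib, ← Finset.mul_sum] at hA hB
    exact Nat.eq_of_mul_eq_mul_left hr (by omega)
  have hle : ∀ j, (e j).2.1 ≤ 1 := by
    intro j
    rcases good j with h | h <;> simp [h]
  -- Otherwise all `p + 1` points carry `y` and none carries `x`, against `hab`.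
  have hex : ∃ j0, (e j0).2.1 = 0 := by
    by_contra! h
    have h1 : ∀ j, e j = (0, 1, 0) := fun j => (good j).resolve_left (h j)
    simp [h1] at hab
  obtain ⟨j0, hj0⟩ := hex
  have hs : ∀ F : Fin (p + 1) → ℕ, ∑ j, F j = F j0 + ∑ j ∈ Finset.univ.erase j0, F j := fun F =>
    (Finset.add_sum_erase _ _ (Finset.mem_univ j0)).symm
  have hcard : (Finset.univ.erase j0).card = p := by simp
  have hsum : ∑ j ∈ Finset.univ.erase j0, (e j).2.1 ≤ ∑ j ∈ Finset.univ.erase j0, 1 :=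
    Finset.sum_le_sum fun j _ => hle j
  have hp : ∑ j ∈ Finset.univ.erase j0, 1 = p := by simp
  refine ⟨by rw [hs, hj0]; omega, fun h => ⟨j0, ?_⟩⟩
  have h1 : ∀ j ∈ Finset.univ.erase j0, (e j).2.1 = 1 := by
    rw [← Finset.sum_eq_sum_iff_of_le fun j _ => hle j, hp]
    rw [hs, hj0] at h
    omega
  have h2 : ∀ j, j ≠ j0 → e j = (0, 1, 0) := fun j hj => (good j).resolve_left (by
    rw [h1 j (Finset.mem_erase.2 ⟨hj, Finset.mem_univ j⟩)]; simp)
  refine ⟨?_, h2⟩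
  have h3 : ∑ j ∈ Finset.univ.erase j0, (e j).1 = 0 :=
    Finset.sum_eq_zero fun j hj => by rw [h2 j (Finset.ne_of_mem_erase hj)]
  have h4 : ∑ j ∈ Finset.univ.erase j0, (r * (e j).1 + (e j).2.2) = 0 :=
    Finset.sum_eq_zero fun j hj => by rw [h2 j (Finset.ne_of_mem_erase hj)]; simp
  rw [h, hs, h3] at hab
  rw [hs, h4] at hA
  have h5 : (e j0).1 = p := by omega
  rw [h5] at hA
  have h6 : (e j0).2.2 = i := by omega
  exact Prod.ext h5 (Prod.ext hj0 h6)

/-- The value does not depend on `j0`: from `η^(r(p+1)) = 1`, the factor `η^(j0 r p)` is `η^(-r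
j0)`, which is what a `y` at that point would give. Hence different contributions cannot cancel. -/
theorem prod_cluster {r p i : ℕ} {η : ℂˣ} (hη : η ^ (r * (p + 1)) = 1)
    (e : Fin (p + 1) → ℕ × ℕ × ℕ) (j0 : Fin (p + 1)) (h0 : e j0 = (p, 0, i))
    (h1 : ∀ j, j ≠ j0 → e j = (0, 1, 0)) :
    ∏ j : Fin (p + 1), ((η ^ (j : ℕ)) ^ (r * (e j).1 + (e j).2.2) *
      (η ^ (j : ℕ))⁻¹ ^ (r * (e j).2.1 + (e j).2.2)) = ∏ j : Fin (p + 1), (η ^ (r * (j : ℕ)))⁻¹ := by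
  rw [← Finset.mul_prod_erase _ _ (Finset.mem_univ j0),
    ← Finset.mul_prod_erase Finset.univ (fun j : Fin (p + 1) => (η ^ (r * (j : ℕ)))⁻¹)
      (Finset.mem_univ j0), h0]
  congr 1
  · simp only [mul_zero, zero_add, inv_pow, pow_add, mul_inv_cancel_right]
    rw [eq_inv_iff_mul_eq_one, ← pow_mul, ← pow_add]
    have : (j0 : ℕ) * (r * p) + r * j0 = r * (p + 1) * j0 := by ring
    rw [this, pow_mul, hη, one_pow]
  · refine Finset.prod_congr rfl fun j hj => ?_
    rw [h1 j (Finset.ne_of_mem_erase hj)]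
    simp [← pow_mul, mul_comm r]

/-! ### Coefficients of `m_Λ` on clusters -/

section Cluster

variable {r n : ℕ} {κ : Type*} {p q : κ → ℕ}

/-- The `j`-th power of `η_c`, at the `j`-th place of the cluster `c`. -/
def clusterPoint (η : κ → ℂˣ) (x : Σ c, Fin (p c + 1)) : ℂˣ := η x.1 ^ (x.2 : ℕ)

theorem sum_ite_cluster [Fintype κ] [DecidableEq κ] (E : Fin n ≃ Σ c, Fin (p c + 1)) (F : Fin n → ℕ) (c : κ) :
    (∑ i, if (E i).1 = c then F i else 0) = ∑ j, F (E.symm ⟨c, j⟩) := by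
  rw [← Equiv.sum_comp E.symm, Fintype.sum_sigma, Finset.sum_eq_single c]
  · simp
  · intro c' _ h
    simp [h]
  · simp

/-- A cyclic shift of the cluster `c` turns `η^j` into `η^(j+1)`, except at the last point, where
`1` appears instead of `η^(p+1)`. That number is an `r`-th root of unity, so the diagonal part of
`g` can correct it. -/
theorem exists_rotation [DecidableEq κ] (E : Fin n ≃ Σ c, Fin (p c + 1)) (η : κ → ℂˣ)
    (hη : ∀ c, η c ^ (r * (p c + 1)) = 1) (c : κ) :
    ∃ g : Wreath r n, (∀ i, (E (g.right i)).1 = (E i).1) ∧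
      ∀ i, ((g.left (g.right i) : ℂˣ))⁻¹ * clusterPoint η (E (g.right i)) =
        (if (E i).1 = c then η c else 1) * clusterPoint η (E i) := by
  let ρ : rootsOfUnity r ℂ := ⟨(η c ^ (p c + 1))⁻¹, by
    rw [mem_rootsOfUnity, inv_pow, ← pow_mul, mul_comm, hη, inv_one]⟩
  let rot : (Σ c, Fin (p c + 1)) ≃ Σ c, Fin (p c + 1) :=
    Equiv.sigmaCongrRight fun c' => if c' = c then finRotate (p c' + 1) else 1
  let σ : Equiv.Perm (Fin n) := E.trans (rot.trans E.symm)
  have hσ : ∀ x, σ (E.symm x) = E.symm (rot x) := fun x => by simp [σ]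
  let l : (Σ c, Fin (p c + 1)) → rootsOfUnity r ℂ := fun x =>
    if x.1 = c ∧ (x.2 : ℕ) = 0 then ρ else 1
  refine ⟨⟨l ∘ E, σ⟩, fun i => ?_, fun i => ?_⟩
  · obtain ⟨⟨c', j⟩, rfl⟩ := E.symm.surjective i
    change (E (σ _)).1 = _
    rw [hσ, E.apply_symm_apply, E.apply_symm_apply]
    rfl
  · obtain ⟨⟨c', j⟩, rfl⟩ := E.symm.surjective i
    change (l (E (σ _)) : ℂˣ)⁻¹ * clusterPoint η (E (σ _)) = _
    rw [hσ, E.apply_symm_apply, E.apply_symm_apply]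
    by_cases h : c' = c
    · subst h
      have hrot : rot ⟨c', j⟩ = ⟨c', finRotate _ j⟩ := by simp [rot]
      rw [hrot]
      by_cases hj : j = Fin.last (p c')
      · subst hj
        simp [l, ρ, clusterPoint, pow_succ']
      · have h1 := coe_finRotate_of_ne_last hj
        have h2 : l ⟨c', finRotate _ j⟩ = 1 := if_neg fun h => by
          simp only [h1] at h
          omega
        rw [h2]
        simp only [clusterPoint, h1, pow_succ']
        simp
    · have hrot : rot ⟨c', j⟩ = ⟨c', j⟩ := by simp [rot, h]
      rw [hrot]
      simp [l, h]

variable [Fintype κ]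

/-- The exponents `e` that contribute to the coefficient of `∏ (s_c t_c)^(r p_c + q_c)`. -/
def IsBalanced (r : ℕ) (q : κ → ℕ) (E : Fin n ≃ Σ c, Fin (p c + 1))
    (e : Fin n → ℕ × ℕ × ℕ) : Prop :=
  ∀ c, ∑ j, (r * (e (E.symm ⟨c, j⟩)).1 + (e (E.symm ⟨c, j⟩)).2.2) = r * p c + q c ∧
    ∑ j, (r * (e (E.symm ⟨c, j⟩)).2.1 + (e (E.symm ⟨c, j⟩)).2.2) = r * p c + q c

/-- Each cluster carries at most `p_c` factors `y`, while all of them together carry `|μ| ≥ ∑ p_c`;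
so every cluster is extremal. -/
theorem IsBalanced.exists_point (hr : 0 < r) {E : Fin n ≃ Σ c, Fin (p c + 1)}
    {mu : Fin r → Multiset ℕ} {e : Fin n → ℕ × ℕ × ℕ} (he : e ∈ orbitExponents n (toTri mu))
    (hb : IsBalanced r q E e) (hsize : ∑ c, p c ≤ size mu) (c : κ) :
    ∃ j0, e (E.symm ⟨c, j0⟩) = (p c, 0, q c) ∧
      ∀ j, j ≠ j0 → e (E.symm ⟨c, j⟩) = (0, 1, 0) := by
  have h1 := fun c => cluster_balanced hr (fun j => e (E.symm ⟨c, j⟩))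
    (fun j => snd_zero_or_of_mem_orbitExponents he _) (hb c).1 (hb c).2
  refine (h1 c).2 ?_
  have h2 : ∑ c, ∑ j, (e (E.symm ⟨c, j⟩)).2.1 = size mu := by
    rw [← sum_snd_of_mem_orbitExponents he, ← Equiv.sum_comp E.symm, Fintype.sum_sigma]
  have h3 := Finset.sum_le_sum fun c (_ : c ∈ Finset.univ) => (h1 c).1
  exact (Finset.sum_eq_sum_iff_of_le fun c _ => (h1 c).1).1 (le_antisymm h3 (h2 ▸ hsize)) c
    (Finset.mem_univ c)

theorem map_univ_eq_of_points {E : Fin n ≃ Σ c, Fin (p c + 1)} {e : Fin n → ℕ × ℕ × ℕ}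
    (h : ∀ c, ∃ j0, e (E.symm ⟨c, j0⟩) = (p c, 0, q c) ∧
      ∀ j, j ≠ j0 → e (E.symm ⟨c, j⟩) = (0, 1, 0)) :
    Finset.univ.val.map e = ∑ c, ((p c, 0, q c) ::ₘ Multiset.replicate (p c) (0, 1, 0)) := by
  have h1 : Finset.univ.val.map e = ∑ i, ({e i} : Multiset (ℕ × ℕ × ℕ)) := by
    rw [← Multiset.sum_map_singleton (Finset.univ.val.map e), Multiset.map_map]
    rfl
  rw [h1, ← Equiv.sum_comp E.symm, Fintype.sum_sigma]
  refine Finset.sum_congr rfl fun c _ => ?_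
  obtain ⟨j0, h0, hj⟩ := h c
  rw [← Finset.add_sum_erase _ _ (Finset.mem_univ j0), h0,
    Finset.sum_congr rfl fun j hj' => by rw [hj j (Finset.ne_of_mem_erase hj')],
    Finset.sum_const, Finset.card_erase_of_mem (Finset.mem_univ j0), Finset.card_univ,
    Fintype.card_fin, Nat.add_sub_cancel, Multiset.nsmul_singleton, Multiset.singleton_add]

/-- All balanced exponents contribute the same unit, so in characteristic zero the coefficient is
nonzero as soon as one balanced exponent exists; any such exponent has the triples of `λ` as its
nonzero values. -/
theorem coeff_clusterHom_monoSymm [DecidableEq κ] (hr : 0 < r) (E : Fin n ≃ Σ c, Fin (p c + 1)) (η : κ → ℂˣ)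
    (hη : ∀ c, η c ^ (r * (p c + 1)) = 1) {lam mu : Fin r → Multiset ℕ}
    (hlam : (∑ c, ((p c, 0, q c) ::ₘ Multiset.replicate (p c) (0, 1, 0))).filter
      (fun v => v ≠ 0) = toTri lam) (hsize : ∑ c, p c ≤ size mu)
    (d : κ ⊕ κ →₀ ℕ) (hl : ∀ c, d (Sum.inl c) = r * p c + q c)
    (hr' : ∀ c, d (Sum.inr c) = r * p c + q c) :
    coeff d (clusterHom (fun i => (E i).1) (fun i => clusterPoint η (E i))
      (triSubst r n (monoSymm n (toTri mu)))) ≠ 0 ↔ mu = lam := by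
  classical
  rw [triSubst_monoSymm, map_sum, coeff_sum]
  set S := (orbitExponents n (toTri mu)).filter (IsBalanced r q E) with hS
  have hpt : ∀ e ∈ S, ∀ c, ∃ j0, e (E.symm ⟨c, j0⟩) = (p c, 0, q c) ∧
      ∀ j, j ≠ j0 → e (E.symm ⟨c, j⟩) = (0, 1, 0) := fun e he c =>
    IsBalanced.exists_point hr (Finset.mem_filter.1 he).1 (Finset.mem_filter.1 he).2 hsize c
  have hval : ∀ e ∈ S, ∏ i, (clusterPoint η (E i) ^ (r * (e i).1 + (e i).2.2) *
      (clusterPoint η (E i))⁻¹ ^ (r * (e i).2.1 + (e i).2.2)) =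
      ∏ c, ∏ j : Fin (p c + 1), (η c ^ (r * (j : ℕ)))⁻¹ := by
    intro e he
    rw [← Equiv.prod_comp E.symm, Fintype.prod_sigma]
    refine Finset.prod_congr rfl fun c _ => ?_
    obtain ⟨j0, h0, h1⟩ := hpt e he c
    rw [← prod_cluster (hη c) (fun j => e (E.symm ⟨c, j⟩)) j0 h0 h1]
    simp only [E.apply_symm_apply]
    rfl
  have hsum : ∀ e ∈ S, ((∏ i, (clusterPoint η (E i) ^ (r * (e i).1 + (e i).2.2) *
      (clusterPoint η (E i))⁻¹ ^ (r * (e i).2.1 + (e i).2.2)) : ℂˣ) : ℂ) =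
      ((∏ c, ∏ j : Fin (p c + 1), (η c ^ (r * (j : ℕ)))⁻¹ : ℂˣ) : ℂ) := fun e he => by
    rw [hval e he]
  have hS' : ∀ e ∈ orbitExponents n (toTri mu), coeff d (clusterHom (fun i => (E i).1)
      (fun i => clusterPoint η (E i)) (∏ i, X (Sum.inl i) ^ (r * (e i).1 + (e i).2.2) *
        X (Sum.inr i) ^ (r * (e i).2.1 + (e i).2.2))) = if IsBalanced r q E e then
      ((∏ i, (clusterPoint η (E i) ^ (r * (e i).1 + (e i).2.2) *
      (clusterPoint η (E i))⁻¹ ^ (r * (e i).2.1 + (e i).2.2)) : ℂˣ) : ℂ) else 0 := fun e _ => by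
    rw [coeff_clusterHom_prod]
    exact if_congr (by simp only [sum_ite_cluster E, hl, hr', IsBalanced]) rfl rfl
  rw [Finset.sum_congr rfl hS', ← Finset.sum_filter, ← hS, Finset.sum_congr rfl hsum, Finset.sum_const, nsmul_eq_mul, mul_ne_zero_iff,
    and_iff_left (Units.ne_zero _), Nat.cast_ne_zero, ← Nat.pos_iff_ne_zero, Finset.card_pos]
  constructor
  · rintro ⟨e, he⟩
    refine toTri_injective ?_
    rw [← hlam, ← map_univ_eq_of_points (hpt e he)]
    exact (mem_orbitExponents.1 (Finset.mem_filter.1 he).1).symm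
  · rintro rfl
    let e' : (Σ c, Fin (p c + 1)) → ℕ × ℕ × ℕ := fun x =>
      if x.2 = 0 then (p x.1, 0, q x.1) else (0, 1, 0)
    let e : Fin n → ℕ × ℕ × ℕ := e' ∘ E
    have hee : ∀ x, e (E.symm x) = e' x := fun x => congrArg e' (E.apply_symm_apply x)
    have hpe : ∀ c, ∃ j0, e (E.symm ⟨c, j0⟩) = (p c, 0, q c) ∧
      ∀ j, j ≠ j0 → e (E.symm ⟨c, j⟩) = (0, 1, 0) := fun c =>
      ⟨0, by simp [hee, e'], fun j hj => by simp [hee, e', hj]⟩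
    refine ⟨e, Finset.mem_filter.2 ⟨?_, fun c => ?_⟩⟩
    · rw [mem_orbitExponents, map_univ_eq_of_points hpe, hlam]
    · simp [hee, e', Fin.sum_univ_succ, mul_comm, add_comm]

end Cluster

/-! ### Separating functionals and linear independence -/

/-- The pairs `(p, i)`, for `p` a part of `λ_i`. -/
def pairs {r : ℕ} (lam : Fin r → Multiset ℕ) : Multiset (ℕ × ℕ) :=
  ∑ i : Fin r, (lam i).map fun p => (p, (i : ℕ))

theorem mem_pairs {r : ℕ} {lam : Fin r → Multiset ℕ} {x : ℕ × ℕ} :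
    x ∈ pairs lam ↔ ∃ i : Fin r, x.1 ∈ lam i ∧ (i : ℕ) = x.2 := by
  obtain ⟨p, j⟩ := x
  simp only [pairs, Multiset.mem_sum, Finset.mem_univ, true_and, Multiset.mem_map, Prod.mk.injEq]
  constructor
  · rintro ⟨i, a, ha, rfl, rfl⟩
    exact ⟨i, ha, rfl⟩
  · rintro ⟨i, ha, rfl⟩
    exact ⟨i, p, ha, rfl, rfl⟩

theorem map_pairs {r : ℕ} {α : Type*} (lam : Fin r → Multiset ℕ) (F : ℕ × ℕ → α) :
    (pairs lam).map F = ∑ i : Fin r, (lam i).map fun p => F (p, (i : ℕ)) := by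
  rw [pairs, ← Multiset.coe_mapAddMonoidHom, map_sum]
  simp

theorem sum_map_pairs {r : ℕ} {α : Type*} [AddCommMonoid α] (lam : Fin r → Multiset ℕ)
    (F : ℕ × ℕ → α) :
    ((pairs lam).map F).sum = ∑ i : Fin r, ((lam i).map fun p => F (p, (i : ℕ))).sum := by
  rw [map_pairs, ← Multiset.coe_sumAddMonoidHom, map_sum]

theorem card_pairs {r : ℕ} (lam : Fin r → Multiset ℕ) : (pairs lam).card = len lam := by
  simp [pairs, len]

theorem toTri_eq {r : ℕ} (lam : Fin r → Multiset ℕ) : toTri lam =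
    ((pairs lam).map fun x => (x.1, 0, x.2)) + Multiset.replicate (size lam) (0, 1, 0) := by
  rw [map_pairs, toTri]

theorem sum_map_cons_replicate (P : Multiset (ℕ × ℕ)) :
    (P.map fun x => ((x.1, 0, x.2) ::ₘ Multiset.replicate x.1 (0, 1, 0) :
      Multiset (ℕ × ℕ × ℕ))).sum =
      (P.map fun x => (x.1, 0, x.2)) + Multiset.replicate (P.map fun x => x.1).sum (0, 1, 0) := by
  induction P using Multiset.induction_on with
  | empty => simp
  | cons a s ih =>
    rw [Multiset.map_cons, Multiset.sum_cons, ih, Multiset.map_cons, Multiset.map_cons,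
      Multiset.sum_cons, Multiset.replicate_add, ← Multiset.singleton_add, ← Multiset.singleton_add]
    abel

theorem exists_functional {r n : ℕ} (hr : 0 < r) (lam : Index r n) :
    ∃ φ : quotRing r n →ₗ[ℂ] ℂ, (∀ f ∈ fixedIdeal r n, φ f = 0) ∧
      ∀ mu : Index r n, size lam.1 ≤ size mu.1 →
        (φ ⟨triSubst r n (monoSymm n (toTri mu.1)), triSubst_monoSymm_mem r n _⟩ ≠ 0 ↔
          mu = lam) := by
  classical
  obtain ⟨lam, h0, hn⟩ := lam
  -- The pairs `(0, 0)` are one-point clusters that use up the remaining points. They yield the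
  -- triple `0`, which the filter removes; no true part is lost, as `0` is not a part of `λ_0`.
  let P : Multiset (ℕ × ℕ) := pairs lam + Multiset.replicate (n - (size lam + len lam)) (0, 0)
  let l := P.toList
  let p : Fin l.length → ℕ := fun c => l[c].1
  let q : Fin l.length → ℕ := fun c => l[c].2
  have hsum : ∀ {α : Type} [AddCommMonoid α] (F : ℕ × ℕ → α),
      ∑ c : Fin l.length, F (p c, q c) = (P.map F).sum := by
    intro α _ F
    change ∑ c : Fin l.length, F l[c] = _
    refine (Fin.sum_univ_fun_getElem l F).trans ?_
    rw [← Multiset.sum_coe, ← Multiset.map_coe, Multiset.coe_toList]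
  have hsize : ∑ c, p c = size lam := by
    rw [hsum fun x => x.1]
    simp [P, sum_map_pairs, size]
  have hcard : ∑ c, (p c + 1) = n := by
    have hlen : (P.map fun _ => 1).sum = len lam + (n - (size lam + len lam)) := by
      simp [P, card_pairs]
    rw [Finset.sum_add_distrib, hsize, hsum fun _ => 1, hlen]
    omega
  have hq : ∀ c, q c < r := by
    intro c
    have hm : l[c] ∈ P := Multiset.mem_toList.1 (List.getElem_mem c.2)
    rcases Multiset.mem_add.1 hm with h | h
    · obtain ⟨i, -, hi⟩ := mem_pairs.1 h
      have h2 : q c = i := hi.symm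
      exact h2 ▸ i.2
    · have h1 := Multiset.eq_of_mem_replicate h
      simp only [q, h1, hr]
  let E : Fin n ≃ Σ c, Fin (p c + 1) := Fintype.equivOfCardEq (by simp [hcard])
  have hη : ∀ c, ∃ η : ℂˣ, IsPrimitiveRoot η (r * (p c + 1)) := fun c => by
    have hN : r * (p c + 1) ≠ 0 := by positivity
    have hp := Complex.isPrimitiveRoot_exp _ hN
    exact ⟨(hp.isUnit hN).unit, IsPrimitiveRoot.coe_units_iff.1 hp⟩
  choose η hη using hη
  -- These exponents lie in the box because `q c < r` gives `r p + q < r (p + 1)`.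
  let d : Fin l.length ⊕ Fin l.length →₀ ℕ :=
    Finsupp.equivFunOnFinite.symm (Sum.elim (fun c => r * p c + q c) fun c => r * p c + q c)
  let Φ := clusterHom (fun i => (E i).1) (fun i => clusterPoint η (E i))
  refine ⟨(lcoeff ℂ d).comp (Φ.toLinearMap.comp (quotRing r n).val.toLinearMap), fun f hf => ?_,
    fun mu hmu => ?_⟩
  · refine coeff_clusterHom_fixedIdeal (fun i => (E i).1) (fun i => clusterPoint η (E i))
      (fun c => r * (p c + 1)) (fun c => ⟨η c, hη c, exists_rotation E η (fun c => (hη c).pow_eq_one) c⟩)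
      f hf d ?_
    rintro (c | c)
    · simpa [d, mul_add] using hq c
    · simpa [d, mul_add] using hq c
  · have hmu2 : mu = ⟨lam, h0, hn⟩ ↔ mu.1 = lam :=
      ⟨fun h => congrArg Subtype.val h, fun h => Subtype.ext h⟩
    rw [hmu2]
    refine coeff_clusterHom_monoSymm (q := q) hr E η (fun c => (hη c).pow_eq_one) ?_
      (hsize.trans_le hmu) d (fun c => rfl) (fun c => rfl)
    rw [hsum fun x => (x.1, 0, x.2) ::ₘ Multiset.replicate x.1 (0, 1, 0)]
    rw [sum_map_cons_replicate, ← hsum fun x => x.1, hsize, Multiset.filter_add, toTri_eq]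
    congr 1
    · rw [Multiset.map_add, Multiset.filter_add, Multiset.filter_eq_self.2, Multiset.map_replicate,
        Multiset.filter_eq_nil.2, add_zero]
      · intro a ha
        rw [Multiset.eq_of_mem_replicate ha]
        simp
      · intro a ha
        obtain ⟨x, hx, rfl⟩ := Multiset.mem_map.1 ha
        obtain ⟨i, hi, hi2⟩ := mem_pairs.1 hx
        intro h
        simp only [Prod.mk_eq_zero] at h
        exact h0 i (hi2.trans h.2.2) (h.1 ▸ hi)
    · rw [Multiset.filter_eq_self]
      intro a ha
      rw [Multiset.eq_of_mem_replicate ha]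
      simp

theorem linearIndependent_monoSymmBar {r n : ℕ} (hr : 0 < r) :
    LinearIndependent ℂ fun lam : Index r n => monoSymmBar r n (toTri lam.1) := by
  classical
  rw [linearIndependent_iff']
  intro s g hg
  by_contra! hne
  obtain ⟨i0, hi0, hgi0⟩ := hne
  -- With `|λ|` minimal among the indices that occur, the functional of `λ` sees only the term of
  -- `λ`.
  obtain ⟨lam, hlam, hmin⟩ := Finset.exists_min_image (s.filter fun i => g i ≠ 0)
    (fun lam => size lam.1) ⟨i0, Finset.mem_filter.2 ⟨hi0, hgi0⟩⟩
  obtain ⟨φ, hφ, hφ2⟩ := exists_functional hr lam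
  have h1 : (∑ mu ∈ s, g mu • (⟨triSubst r n (monoSymm n (toTri mu.1)),
      triSubst_monoSymm_mem r n _⟩ : quotRing r n)) ∈ fixedIdeal r n := by
    rw [← Ideal.Quotient.eq_zero_iff_mem, ← hg, ← Ideal.Quotient.mkₐ_eq_mk ℂ, map_sum]
    simp only [map_smul]
    rfl
  have h2 := hφ _ h1
  rw [map_sum, Finset.sum_eq_single lam] at h2
  · rw [map_smul, smul_eq_mul, mul_eq_zero] at h2
    exact h2.elim (Finset.mem_filter.1 hlam).2 ((hφ2 lam le_rfl).2 rfl)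
  · intro mu hmu hne
    by_cases h : g mu = 0
    · rw [h, zero_smul, map_zero]
    · rw [map_smul, not_not.1 (mt (hφ2 mu (hmin mu (Finset.mem_filter.2 ⟨hmu, h⟩))).1 hne),
        smul_zero]
  · intro h
    exact absurd (Finset.mem_filter.1 hlam).1 h

/-! ### Orbit sums of monomials -/

section Reynolds

variable {r n : ℕ}

/-- The monomial `∏ X_i^(a_i) Y_i^(b_i)`, where `e_i = (a_i, b_i)`. -/
noncomputable def mon (e : Fin n → ℕ × ℕ) : Poly n :=
  ∏ i, X (Sum.inl i) ^ (e i).1 * X (Sum.inr i) ^ (e i).2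

theorem mon_add (e e' : Fin n → ℕ × ℕ) : mon (e + e') = mon e * mon e' := by
  rw [mon, mon, mon, ← Finset.prod_mul_distrib]
  refine Finset.prod_congr rfl fun i _ => ?_
  simp only [Pi.add_apply, Prod.fst_add, Prod.snd_add, pow_add]
  ring

theorem mon_single (i : Fin n) (x : ℕ × ℕ) :
    mon (Pi.single i x) = X (Sum.inl i) ^ x.1 * X (Sum.inr i) ^ x.2 := by
  rw [mon, Finset.prod_eq_single i]
  · simp
  · intro j _ h
    simp [h]
  · simp

theorem span_range_mon : Submodule.span ℂ (Set.range (mon (n := n))) = ⊤ := by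
  rw [eq_top_iff]
  intro f _
  rw [← support_sum_monomial_coeff f]
  refine Submodule.sum_mem _ fun m _ => ?_
  have h : monomial m (coeff m f) =
      coeff m f • mon fun i => (m (Sum.inl i), m (Sum.inr i)) := by
    rw [monomial_eq, Finsupp.prod_fintype _ _ (by simp), Fintype.prod_sum_type,
      ← Finset.prod_mul_distrib, smul_eq_C_mul, mon]
  rw [h]
  exact Submodule.smul_mem _ _ (Submodule.subset_span ⟨_, rfl⟩)

theorem wreathAct_perm_mon (σ : Equiv.Perm (Fin n)) (e : Fin n → ℕ × ℕ) :
    wreathAct r n ⟨1, σ⟩ (mon (e ∘ σ)) = mon e := by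
  rw [mon, mon, map_prod]
  refine (Finset.prod_congr rfl fun i _ => ?_).trans (Equiv.prod_comp σ fun i =>
    (X (Sum.inl i) ^ (e i).1 * X (Sum.inr i) ^ (e i).2 : Poly n))
  have hx := wreathHom_inl r n ⟨1, σ⟩ i
  have hy := wreathHom_inr r n ⟨1, σ⟩ i
  change wreathHom r n ⟨1, σ⟩ _ = _
  simp only [map_mul, map_pow, hx, hy]
  simp

theorem wreathAct_diag_mon (ζ : rootsOfUnity r ℂ) (i : Fin n) (e : Fin n → ℕ × ℕ) :
    wreathAct r n ⟨Pi.mulSingle i ζ, 1⟩ (mon e) =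
      (((ζ⁻¹ ^ (e i).1 * ζ ^ (e i).2 : rootsOfUnity r ℂ) : ℂˣ) : ℂ) • mon e := by
  have h : ∀ j, wreathAct r n ⟨Pi.mulSingle i ζ, 1⟩
      (X (Sum.inl j) ^ (e j).1 * X (Sum.inr j) ^ (e j).2) =
      C (if i = j then (((ζ⁻¹ ^ (e i).1 * ζ ^ (e i).2 : rootsOfUnity r ℂ) : ℂˣ) : ℂ) else 1) *
      (X (Sum.inl j) ^ (e j).1 * X (Sum.inr j) ^ (e j).2) := by
    intro j
    have hx := wreathHom_inl r n ⟨Pi.mulSingle i ζ, 1⟩ j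
    have hy := wreathHom_inr r n ⟨Pi.mulSingle i ζ, 1⟩ j
    change wreathHom r n ⟨Pi.mulSingle i ζ, 1⟩ _ = _
    simp only [map_mul, map_pow, hx, hy]
    by_cases hij : i = j
    · subst hij
      simp [mul_pow]
      rw [← inv_pow, C_pow]
      ring
    · simp [hij]
  rw [mon, map_prod, Finset.prod_congr rfl fun j _ => h j, Finset.prod_mul_distrib, smul_eq_C_mul,
    ← map_prod, Finset.prod_ite_eq, if_pos (Finset.mem_univ i)]

/-- Here `t · a - a = (c - 1) a` with `c - 1` invertible. -/
theorem mem_fixedIdeal_of_weight (a : quotRing r n) (t : ℂˣ) (c : ℂ) (hc : c ≠ 1)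
    (h : scale n t ((t⁻¹ : ℂˣ) : ℂ) a.1 = c • a.1) : a ∈ fixedIdeal r n := by
  have h1 : torusAct r n t a - a = (c - 1) • a := by
    rw [sub_smul, one_smul]
    congr 1
    exact Subtype.ext h
  have h2 : (c - 1) • a ∈ fixedIdeal r n := h1 ▸ Ideal.subset_span ⟨t, a, rfl⟩
  have h3 := (fixedIdeal r n).smul_of_tower_mem (c - 1)⁻¹ h2
  rwa [inv_smul_smul₀ (sub_ne_zero.2 hc)] at h3

variable [Fintype (Wreath r n)]

variable (r n) in
/-- The sum over the orbit under the wreath product. -/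
noncomputable def orbitSum : Poly n →ₗ[ℂ] quotRing r n where
  toFun f := ⟨∑ g : Wreath r n, wreathAct r n g f, fun h => by
    rw [map_sum, ← Equiv.sum_comp (Equiv.mulLeft h) fun g => wreathAct r n g f]
    refine Finset.sum_congr rfl fun g _ => ?_
    rw [Equiv.coe_mulLeft, map_mul]
    rfl⟩
  map_add' f g := Subtype.ext (by simp [Finset.sum_add_distrib])
  map_smul' c f := Subtype.ext (by simp [Finset.smul_sum])

variable (r n) in
/-- The class in `ℂ[Z_n^𝕋]` of the sum over the orbit under the wreath product. -/
noncomputable def orbitSumBar : Poly n →ₗ[ℂ] FixedRing r n :=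
  (Ideal.Quotient.mkₐ ℂ (fixedIdeal r n)).toLinearMap ∘ₗ orbitSum r n

theorem orbitSumBar_apply (f : Poly n) :
    orbitSumBar r n f = Ideal.Quotient.mk (fixedIdeal r n) (orbitSum r n f) := rfl

theorem orbitSumBar_wreathAct (g : Wreath r n) (f : Poly n) :
    orbitSumBar r n (wreathAct r n g f) = orbitSumBar r n f := by
  rw [orbitSumBar_apply, orbitSumBar_apply]
  congr 1
  apply Subtype.ext
  change ∑ h : Wreath r n, wreathAct r n h (wreathAct r n g f) = ∑ h : Wreath r n, wreathAct r n h f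
  rw [← Equiv.sum_comp (Equiv.mulRight g) fun h => wreathAct r n h f]
  refine Finset.sum_congr rfl fun h _ => ?_
  rw [Equiv.coe_mulRight, map_mul]
  rfl

theorem orbitSum_mul (a : quotRing r n) (f : Poly n) :
    orbitSum r n (a.1 * f) = a * orbitSum r n f := by
  apply Subtype.ext
  change ∑ h : Wreath r n, wreathAct r n h (a.1 * f) = a.1 * ∑ h : Wreath r n, wreathAct r n h f
  rw [Finset.mul_sum]
  exact Finset.sum_congr rfl fun h _ => by rw [map_mul, a.2 h]

theorem orbitSum_coe (a : quotRing r n) :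
    orbitSum r n a.1 = (Fintype.card (Wreath r n) : ℂ) • a := by
  apply Subtype.ext
  change ∑ h : Wreath r n, wreathAct r n h a.1 = (Fintype.card (Wreath r n) : ℂ) • a.1
  rw [Finset.sum_congr rfl fun h _ => a.2 h, Finset.sum_const, Finset.card_univ, Nat.cast_smul_eq_nsmul]

theorem range_orbitSumBar : LinearMap.range (orbitSumBar r n) = ⊤ := by
  rw [LinearMap.range_eq_top]
  intro x
  obtain ⟨a, rfl⟩ := Ideal.Quotient.mk_surjective x
  refine ⟨(Fintype.card (Wreath r n) : ℂ)⁻¹ • a.1, ?_⟩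
  rw [map_smul, orbitSumBar_apply, orbitSum_coe, ← Ideal.Quotient.mkₐ_eq_mk ℂ, map_smul,
    inv_smul_smul₀ (Nat.cast_ne_zero.2 Fintype.card_ne_zero)]

/-- Orbit summation is linear over the invariants. This is the source of all relations used for
spanning; `f` itself need not be invariant. -/
theorem orbitSumBar_mul_eq_zero {a : Poly n} (ha : a ∈ quotRing r n) (t : ℂˣ) (c : ℂ) (hc : c ≠ 1)
    (h : scale n t ((t⁻¹ : ℂˣ) : ℂ) a = c • a) (f : Poly n) : orbitSumBar r n (a * f) = 0 := by
  rw [orbitSumBar_apply, orbitSum_mul ⟨a, ha⟩, Ideal.Quotient.eq_zero_iff_mem]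
  exact Ideal.mul_mem_right _ _ (mem_fixedIdeal_of_weight ⟨a, ha⟩ t c hc h)

theorem orbitSumBar_mon_comp (σ : Equiv.Perm (Fin n)) (e : Fin n → ℕ × ℕ) :
    orbitSumBar r n (mon (e ∘ σ)) = orbitSumBar r n (mon e) := by
  rw [← wreathAct_perm_mon (r := r) σ e, orbitSumBar_wreathAct]

/-- A primitive `r`-th root acting on the plane `i` alone scales the monomial but not its orbit sum.
-/
theorem modEq_of_orbitSumBar_ne_zero (hr : 0 < r) {e : Fin n → ℕ × ℕ}
    (he : orbitSumBar r n (mon e) ≠ 0) (i : Fin n) : (e i).1 ≡ (e i).2 [MOD r] := by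
  have hp := Complex.isPrimitiveRoot_exp r hr.ne'
  have : NeZero r := ⟨hr.ne'⟩
  have h1 := orbitSumBar_wreathAct (r := r) ⟨Pi.mulSingle i hp.toRootsOfUnity, 1⟩ (mon e)
  rw [wreathAct_diag_mon, map_smul] at h1
  have h2 := smul_left_injective ℂ he (h1.trans (one_smul ℂ _).symm)
  have h3 : hp.toRootsOfUnity⁻¹ ^ (e i).1 * hp.toRootsOfUnity ^ (e i).2 = 1 :=
    Subtype.ext (Units.ext h2)
  rw [inv_pow, inv_mul_eq_one] at h3
  rwa [pow_eq_pow_iff_modEq, ← Subgroup.orderOf_coe, ← orderOf_units, hp.val_toRootsOfUnity_coe,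
    ← hp.eq_orderOf] at h3

end Reynolds

/-! ### Straightening modulo monomials on fewer planes -/

section Straightening

variable {r n : ℕ}

theorem scale_mon (α β : ℂ) (e : Fin n → ℕ × ℕ) :
    scale n α β (mon e) = (∏ i, α ^ (e i).1 * β ^ (e i).2) • mon e := by
  rw [mon, map_prod, smul_eq_C_mul, map_prod, ← Finset.prod_mul_distrib]
  refine Finset.prod_congr rfl fun i _ => ?_
  simp [scale, mul_pow]
  ring

theorem sum_mon_single_mem {x : ℕ × ℕ} (hx : x.1 ≡ x.2 [MOD r]) :
    ∑ i : Fin n, mon (Pi.single i x) ∈ quotRing r n := by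
  intro g
  rw [map_sum]
  refine (Finset.sum_congr rfl fun i _ => ?_).trans
    (Equiv.sum_comp g.right fun i => (mon (Pi.single i x) : Poly n))
  have h1 := wreathHom_inl r n g i
  have h2 := wreathHom_inr r n g i
  rw [mon_single, mon_single]
  change wreathHom r n g _ = _
  rw [map_mul, map_pow, map_pow, h1, h2, mul_pow, mul_pow, mul_mul_mul_comm, ← C_pow, ← C_pow,
    ← C_mul]
  have h3 : (g.left (g.right i))⁻¹ ^ x.1 * g.left (g.right i) ^ x.2 = 1 := by
    rw [inv_pow, inv_mul_eq_one, pow_eq_pow_iff_modEq]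
    refine hx.of_dvd (orderOf_dvd_of_pow_eq_one ?_)
    exact Subtype.ext ((mem_rootsOfUnity r _).1 (g.left (g.right i)).2)
  have h4 := congrArg (fun x : rootsOfUnity r ℂ => ((x : ℂˣ) : ℂ)) h3
  simp only [Subgroup.coe_mul, Subgroup.coe_pow, Units.val_mul, Units.val_pow_eq_pow_val] at h4
  rw [h4]
  simp

theorem two_pow_mul_inv_pow_ne_one {a b : ℕ} (h : a ≠ b) : (2 : ℂ) ^ a * (2 : ℂ)⁻¹ ^ b ≠ 1 := by
  rw [inv_pow, Ne, mul_inv_eq_one₀ (pow_ne_zero _ two_ne_zero)]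
  intro h'
  exact h (Nat.pow_right_injective le_rfl (by exact_mod_cast h'))

/-- The elementary symmetric polynomial of degree `K` in the `Y_i^r` with `i ∈ T`. -/
noncomputable def elemY (r : ℕ) (T : Finset (Fin n)) (K : ℕ) : Poly n :=
  ∑ A ∈ T.powersetCard K, ∏ i ∈ A, X (Sum.inr i) ^ r

theorem elemY_zero (T : Finset (Fin n)) : elemY r T 0 = 1 := by
  simp [elemY]

theorem elemY_insert {T : Finset (Fin n)} {i : Fin n} (hi : i ∉ T) (K : ℕ) :
    elemY r (insert i T) (K + 1) = elemY r T (K + 1) + X (Sum.inr i) ^ r * elemY r T K := by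
  have hA : ∀ A ∈ T.powersetCard K, i ∉ A := fun A h h' => hi ((Finset.mem_powersetCard.1 h).1 h')
  rw [elemY, Finset.powersetCard_succ_insert hi, Finset.sum_union, Finset.sum_image, elemY, elemY,
    Finset.mul_sum]
  · congr 1
    exact Finset.sum_congr rfl fun A h => Finset.prod_insert (hA A h)
  · intro A h B h' hAB
    rw [← Finset.erase_insert (hA A h), ← Finset.erase_insert (hA B h')]
    exact congrArg (fun s => Finset.erase s i) hAB
  · rw [Finset.disjoint_left]
    intro A h h'
    obtain ⟨B, -, rfl⟩ := Finset.mem_image.1 h'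
    exact hi ((Finset.mem_powersetCard.1 h).1 (Finset.mem_insert_self i B))

theorem elemY_univ_mem (K : ℕ) : elemY r (Finset.univ : Finset (Fin n)) K ∈ quotRing r n := by
  have h1 : elemY r (Finset.univ : Finset (Fin n)) K =
      aeval (fun i => X (Sum.inr i) ^ r) (esymm (Fin n) ℂ K) := by
    simp [elemY, esymm]
  intro g
  have h2 : ((wreathAct r n g).comp (aeval fun i => X (Sum.inr i) ^ r)) =
      (aeval fun i => (X (Sum.inr i) ^ r : Poly n)).comp (rename g.right) := by
    apply MvPolynomial.algHom_ext
    intro i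
    have := wreathAct_triSubst_X r n g i 1
    simpa [triSubst] using this
  have h3 := DFunLike.congr_fun h2 (esymm (Fin n) ℂ K)
  rw [AlgHom.comp_apply, AlgHom.comp_apply, rename_esymm] at h3
  rw [h1, h3]

theorem scale_elemY (α β : ℂ) (T : Finset (Fin n)) (K : ℕ) :
    scale n α β (elemY r T K) = β ^ (r * K) • elemY r T K := by
  rw [elemY, map_sum, Finset.smul_sum]
  refine Finset.sum_congr rfl fun A hA => ?_
  rw [map_prod, ← (Finset.mem_powersetCard.1 hA).2, pow_mul, ← Finset.prod_const, smul_eq_C_mul,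
    map_prod, ← Finset.prod_mul_distrib]
  refine Finset.prod_congr rfl fun i _ => ?_
  simp [scale, mul_pow]

/-- The places where the monomial `mon e` is not trivial. -/
def places (e : Fin n → ℕ × ℕ) : Finset (Fin n) := Finset.univ.filter fun i => e i ≠ 0

theorem mem_places {e : Fin n → ℕ × ℕ} {i : Fin n} : i ∈ places e ↔ e i ≠ 0 := by
  simp [places]

/-- The exponents of `∏ X_i^(a_i) Y_i^(a_i % r + r k_i)`. -/
def withY (r : ℕ) (a k : Fin n → ℕ) : Fin n → ℕ × ℕ := fun i => (a i, a i % r + r * k i)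

theorem withY_add_single (a k : Fin n → ℕ) (i : Fin n) :
    mon (withY r a (k + Pi.single i 1)) = X (Sum.inr i) ^ r * mon (withY r a k) := by
  have h : withY r a (k + Pi.single i 1) = Pi.single i (0, r) + withY r a k := by
    funext j
    by_cases hj : j = i
    · subst hj
      simp [withY, mul_add, add_comm, add_left_comm]
    · simp [withY, hj]
  rw [h, mon_add, mon_single]
  simp

variable [Fintype (Wreath r n)]

variable (r n) in
/-- The span of the classes of the monomials that are nontrivial at less than `l` places. -/
noncomputable def fewPlaces (l : ℕ) : Submodule ℂ (FixedRing r n) :=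
  Submodule.span ℂ ((fun e => orbitSumBar r n (mon e)) '' {e | (places e).card < l})

theorem orbitSumBar_mem_fewPlaces {e : Fin n → ℕ × ℕ} {l : ℕ} (h : (places e).card < l) :
    orbitSumBar r n (mon e) ∈ fewPlaces r n l :=
  Submodule.subset_span ⟨e, h, rfl⟩

/-- Remove the unbalanced factor at `i` and multiply the rest by the power sum of that factor over
all planes, which has nonzero weight. Terms landing on an occupied plane involve fewer planes; the
others are all conjugate to `mon e`, and there is at least one. -/
theorem orbitSumBar_mem_of_unbalanced (hr : 0 < r) {e : Fin n → ℕ × ℕ} {i : Fin n}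
    (hi : (e i).1 ≠ (e i).2) : orbitSumBar r n (mon e) ∈ fewPlaces r n (places e).card := by
  by_cases h0 : orbitSumBar r n (mon e) = 0
  · rw [h0]; exact Submodule.zero_mem _
  have hmod := modEq_of_orbitSumBar_ne_zero hr h0 i
  set e' := Function.update e i 0 with he'
  have hie : i ∈ places e := mem_places.2 fun h => hi (by rw [h]; rfl)
  have hpl : places e' = (places e).erase i := by
    ext j
    rw [Finset.mem_erase, mem_places, mem_places, he']
    by_cases hj : j = i
    · simp [hj]
    · simp [hj]
  have hrel : orbitSumBar r n ((∑ j, mon (Pi.single j (e i))) * mon e') = 0 := by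
    refine orbitSumBar_mul_eq_zero (sum_mon_single_mem hmod) (Units.mk0 2 two_ne_zero) _
      (two_pow_mul_inv_pow_ne_one hi) ?_ _
    rw [map_sum, Finset.smul_sum]
    refine Finset.sum_congr rfl fun j _ => ?_
    rw [scale_mon, Finset.prod_eq_single j]
    · simp
    · intro k _ hk
      simp [hk]
    · simp
  rw [Finset.sum_mul, map_sum, ← Finset.sum_add_sum_compl (places e')] at hrel
  have h1 : ∀ j ∈ (places e')ᶜ, orbitSumBar r n (mon (Pi.single j (e i)) * mon e') =
      orbitSumBar r n (mon e) := by
    intro j hj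
    rw [← orbitSumBar_mon_comp (Equiv.swap i j) e, ← mon_add]
    congr 2
    have hj0 : e' j = 0 := by
      simpa [mem_places] using hj
    funext k
    rw [Pi.add_apply, Function.comp_apply]
    by_cases hkj : k = j
    · subst hkj
      simp [hj0]
    · by_cases hki : k = i
      · subst hki
        have : e j = 0 := by
          rw [← hj0, he', Function.update_of_ne (Ne.symm hkj)]
        simp [hkj, he', this]
      · simp [hkj, hki, he', Equiv.swap_apply_of_ne_of_ne]
  have h2 : ∑ j ∈ places e', orbitSumBar r n (mon (Pi.single j (e i)) * mon e') ∈
      fewPlaces r n (places e).card := by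
    refine Submodule.sum_mem _ fun j hj => ?_
    rw [← mon_add]
    refine orbitSumBar_mem_fewPlaces (lt_of_le_of_lt (Finset.card_le_card ?_)
      (Finset.card_erase_lt_of_mem hie))
    rw [← hpl]
    intro k hk
    rw [mem_places, Pi.add_apply] at hk
    by_cases hkj : k = j
    · rwa [hkj]
    · rw [mem_places]
      simpa [hkj] using hk
  rw [Finset.sum_congr rfl h1, Finset.sum_const, ← Nat.cast_smul_eq_nsmul ℂ] at hrel
  have h3 := (Submodule.add_mem_iff_right _ h2).1 (hrel ▸ Submodule.zero_mem _)
  have h4 : ((places e')ᶜ.card : ℂ) ≠ 0 := by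
    rw [Nat.cast_ne_zero, ← Nat.pos_iff_ne_zero, Finset.card_pos]
    exact ⟨i, by simp [hpl]⟩
  exact (Submodule.smul_mem_iff _ h4).1 h3

/-- As both sums agree, the condition in the `if` forces `k i = a i / r` everywhere, whatever `T`
is. If this fails, some plane is unbalanced. -/
theorem straighten_base (hr : 0 < r) (a k : Fin n → ℕ) (ha : ∀ i, a i = 0 → k i = 0)
    (hk : ∑ i, k i = ∑ i, a i / r) (T : Finset (Fin n)) :
    orbitSumBar r n (mon (withY r a k)) -
      (if (∀ i, k i ≤ a i / r) ∧ ∀ i ∈ T, k i = a i / r then (1 : ℂ) else 0) •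
        orbitSumBar r n (mon fun i => (a i, a i)) ∈
      fewPlaces r n (places fun i => (a i, a i)).card := by
  by_cases h : ∀ i, k i = a i / r
  · have h1 : withY r a k = fun i => (a i, a i) := by
      funext i
      rw [withY, h, Nat.mod_add_div]
    rw [if_pos ⟨fun i => (h i).le, fun i _ => h i⟩, h1, one_smul, sub_self]
    exact Submodule.zero_mem _
  · have hno : ¬((∀ i, k i ≤ a i / r) ∧ ∀ i ∈ T, k i = a i / r) := fun hh =>
      h fun i => (Finset.sum_eq_sum_iff_of_le fun i _ => hh.1 i).1 hk i (Finset.mem_univ i)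
    rw [if_neg hno, zero_smul, sub_zero]
    obtain ⟨i, hi⟩ := not_forall.1 h
    have h1 : places (withY r a k) = places fun i => (a i, a i) := by
      ext j
      rw [mem_places, mem_places, not_iff_not]
      simp only [withY, Prod.mk_eq_zero, and_self]
      refine ⟨fun h => h.1, fun h => ⟨h, ?_⟩⟩
      simp [h, ha j h]
    rw [← h1]
    refine orbitSumBar_mem_of_unbalanced hr (i := i) fun h2 => hi ?_
    simp only [withY] at h2
    have h3 := Nat.mod_add_div (a i) r
    exact Nat.eq_of_mul_eq_mul_left hr (by omega)

/-- Induction on `U`, then on `K`, by `e_(K+1)(T ∪ {i}) = e_(K+1)(T) + y_i e_K(T)`; the factor `y_i`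
raises `k i` by one. For `U = ∅` and `K > 0` the symmetric function lies in `J_n`. The case needed
is `U` the support of `a` and `k = 0`, where the coefficient is `(-1)^K`. -/
theorem straighten (hr : 0 < r) (a : Fin n → ℕ) (U : Finset (Fin n)) (hU : ∀ i ∈ U, a i ≠ 0) :
    ∀ (K : ℕ) (k : Fin n → ℕ), (∀ i, a i = 0 → k i = 0) → ∑ i, k i + K = ∑ i, a i / r →
    orbitSumBar r n (mon (withY r a k) * elemY r Uᶜ K) -
      (if (∀ i, k i ≤ a i / r) ∧ ∀ i ∈ Uᶜ, k i = a i / r then (-1 : ℂ) ^ K else 0) •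
        orbitSumBar r n (mon fun i => (a i, a i)) ∈
      fewPlaces r n (places fun i => (a i, a i)).card := by
  induction U using Finset.induction_on with
  | empty =>
    intro K k ha hk
    rcases Nat.eq_zero_or_pos K with rfl | hK
    · rw [elemY_zero, mul_one]
      simpa using straighten_base hr a k ha hk (∅ : Finset (Fin n))ᶜ
    · rw [Finset.compl_empty, mul_comm, orbitSumBar_mul_eq_zero (elemY_univ_mem K)
        (Units.mk0 2 two_ne_zero) _ ?_ (scale_elemY _ _ _ _), if_neg, zero_smul, sub_zero]
      · exact Submodule.zero_mem _
      · rintro ⟨-, h⟩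
        rw [Finset.sum_congr rfl h] at hk
        omega
      · have := two_pow_mul_inv_pow_ne_one (a := 0) (b := r * K) (by positivity)
        simpa using this
  | insert i U hiU ih =>
    have ih := ih fun j hj => hU j (Finset.mem_insert_of_mem hj)
    intro K
    induction K with
    | zero =>
      intro k ha hk
      rw [elemY_zero, mul_one]
      simpa using straighten_base hr a k ha hk (insert i U)ᶜ
    | succ K ihK =>
      intro k ha hk
      have h1 := ih (K + 1) k ha hk
      have h2 := ihK (k + Pi.single i 1) (fun j hj => by
        have hji : j ≠ i := fun h => hU i (Finset.mem_insert_self i U) (h ▸ hj)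
        simp [ha j hj, hji]) (by
        simp only [Pi.add_apply, Finset.sum_add_distrib, Finset.sum_pi_single', Finset.mem_univ,
          if_true]
        omega)
      have hins : insert i (insert i U)ᶜ = Uᶜ := by
        ext j
        by_cases hj : j = i
        · simp [hj, hiU]
        · simp [hj]
      rw [← hins, elemY_insert (by simp), hins, mul_add, map_add] at h1
      rw [withY_add_single, mul_comm (X _ ^ _), mul_assoc] at h2
      have h3 := Submodule.sub_mem _ h1 h2
      convert h3 using 1
      -- The coefficients obey the same recursion: if `k i < a i / r` only the second term survives,
      -- with a change of sign; if `k i = a i / r` only the first.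
      have hc : (if (∀ j, k j ≤ a j / r) ∧ ∀ j ∈ (insert i U)ᶜ, k j = a j / r then
          (-1 : ℂ) ^ (K + 1) else 0) =
          (if (∀ j, k j ≤ a j / r) ∧ ∀ j ∈ Uᶜ, k j = a j / r then (-1 : ℂ) ^ (K + 1) else 0) -
          (if (∀ j, (k + Pi.single i 1 : Fin n → ℕ) j ≤ a j / r) ∧
            ∀ j ∈ (insert i U)ᶜ, (k + Pi.single i 1 : Fin n → ℕ) j = a j / r then (-1 : ℂ) ^ K else 0) := by
        have hT : (∀ j ∈ Uᶜ, k j = a j / r) ↔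
            k i = a i / r ∧ ∀ j ∈ (insert i U)ᶜ, k j = a j / r := by
          rw [← hins, Finset.forall_mem_insert]
        have hk2 : (∀ j ∈ (insert i U)ᶜ, (k + Pi.single i 1 : Fin n → ℕ) j = a j / r) ↔
            ∀ j ∈ (insert i U)ᶜ, k j = a j / r := by
          refine forall₂_congr fun j hj => ?_
          have hji : j ≠ i := fun h => by simp [h] at hj
          simp [hji]
        have hk1 : (∀ j, (k + Pi.single i 1 : Fin n → ℕ) j ≤ a j / r) ↔
            (∀ j, k j ≤ a j / r) ∧ k i + 1 ≤ a i / r := by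
          constructor
          · intro h
            refine ⟨fun j => le_trans (by simp) (h j), by simpa using h i⟩
          · rintro ⟨h, hi⟩ j
            by_cases hj : j = i
            · subst hj; simpa using hi
            · simpa [hj] using h j
        simp only [hT, hk2, hk1]
        by_cases hA : ∀ j, k j ≤ a j / r
        · by_cases hB : ∀ j ∈ (insert i U)ᶜ, k j = a j / r
          · rcases (hA i).lt_or_eq with h | h
            · rw [if_pos ⟨hA, hB⟩, if_neg fun hh => h.ne hh.2.1, if_pos ⟨⟨hA, h⟩, hB⟩, pow_succ]
              ring
            · rw [if_pos ⟨hA, hB⟩, if_pos ⟨hA, h, hB⟩, if_neg fun hh => by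
                have := hh.1.2
                omega, sub_zero]
          · rw [if_neg fun hh => hB hh.2, if_neg fun hh => hB hh.2.2, if_neg fun hh => hB hh.2,
              sub_zero]
        · rw [if_neg fun hh => hA hh.1, if_neg fun hh => hA hh.1, if_neg fun hh => hA hh.1.1,
            sub_zero]
      rw [hc, sub_smul]
      abel

end Straightening

/-! ### The `m_λ` span -/

section Spanning

variable {r n : ℕ}

theorem exists_perm_of_mem_orbitExponents {Λ : Multiset (ℕ × ℕ × ℕ)} {e e' : Fin n → ℕ × ℕ × ℕ}
    (he : e ∈ orbitExponents n Λ) (he' : e' ∈ orbitExponents n Λ) :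
    ∃ σ : Equiv.Perm (Fin n), e' = e ∘ σ := by
  have key : ∀ s : Multiset (ℕ × ℕ × ℕ),
      s = s.filter (fun v => v ≠ 0) + Multiset.replicate (s.card - (s.filter fun v => v ≠ 0).card) 0 := by
    intro s
    have h1 := Multiset.filter_add_not (fun v => v ≠ 0) s
    have h2 := congrArg Multiset.card h1
    rw [Multiset.card_add] at h2
    have h3 : s.filter (fun v => ¬ v ≠ 0) =
        Multiset.replicate (s.filter fun v => ¬ v ≠ 0).card 0 :=
      Multiset.eq_replicate_card.2 fun b hb => not_not.1 (Multiset.mem_filter.1 hb).2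
    have h4 : s.card - (s.filter fun v => v ≠ 0).card = (s.filter fun v => ¬ v ≠ 0).card := by
      omega
    rw [h4, ← h3, h1]
  have h : Finset.univ.val.map e' = Finset.univ.val.map e := by
    rw [key (Finset.univ.val.map e'), key (Finset.univ.val.map e), mem_orbitExponents.1 he,
      mem_orbitExponents.1 he']
    simp
  have hc : ∀ v, Nonempty ({i // e' i = v} ≃ {i // e i = v}) := fun v => by
    have h1 := congrArg (Multiset.count v) h
    rw [Multiset.count_map, Multiset.count_map] at h1
    refine ⟨Fintype.equivOfCardEq ?_⟩
    rw [Fintype.card_subtype, Fintype.card_subtype]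
    simpa only [Finset.card_def, Finset.filter_val, eq_comm] using h1
  refine ⟨Equiv.ofFiberEquiv fun v => (hc v).some, funext fun i => ?_⟩
  exact (Equiv.ofFiberEquiv_map _ i).symm

/-- The exponents in the `X_i`, `Y_i` of a monomial in the `x_i`, `y_i`, `z_i`. -/
def triExponents (r : ℕ) (e : Fin n → ℕ × ℕ × ℕ) : Fin n → ℕ × ℕ := fun i =>
  (r * (e i).1 + (e i).2.2, r * (e i).2.1 + (e i).2.2)

theorem triSubst_monoSymm_eq_sum_mon (Λ : Multiset (ℕ × ℕ × ℕ)) :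
    triSubst r n (monoSymm n Λ) = ∑ e ∈ orbitExponents n Λ, mon (triExponents r e) :=
  triSubst_monoSymm r n Λ

/-- The tuple of multisets that collects the `a_i / r` according to the remainder of `a_i ≠ 0`. -/
def quotientParts (r : ℕ) (a : Fin n → ℕ) : Fin r → Multiset ℕ := fun j =>
  (Finset.univ.filter fun i => a i ≠ 0 ∧ a i % r = j).val.map fun i => a i / r

theorem sum_quotientParts (hr : 0 < r) (a : Fin n → ℕ) {α : Type*} [AddCommMonoid α]
    (F : ℕ → ℕ → α) : ∑ j : Fin r, ((quotientParts r a j).map fun p => F p j).sum =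
      ∑ i with a i ≠ 0, F (a i / r) (a i % r) := by
  rw [← Finset.sum_fiberwise_of_maps_to (t := Finset.univ)
    (g := fun i => (⟨a i % r, Nat.mod_lt _ hr⟩ : Fin r)) fun _ _ => Finset.mem_univ _]
  refine Finset.sum_congr rfl fun j _ => ?_
  rw [quotientParts, Multiset.map_map, Finset.filter_filter]
  change (∑ i with a i ≠ 0 ∧ a i % r = j, F (a i / r) j) = _
  refine Finset.sum_congr ?_ fun i hi => ?_
  · ext i
    simp [Fin.ext_iff]
  · rw [← (Finset.mem_filter.1 hi).2.2]

theorem size_quotientParts (hr : 0 < r) (a : Fin n → ℕ) :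
    size (quotientParts r a) = ∑ i, a i / r := by
  have := sum_quotientParts hr a fun p _ => p
  simp only [Multiset.map_id'] at this
  rw [size, this, Finset.sum_filter]
  refine Finset.sum_congr rfl fun i _ => ?_
  split_ifs with h
  · rfl
  · rw [not_not.1 h, Nat.zero_div]

theorem len_quotientParts (hr : 0 < r) (a : Fin n → ℕ) :
    len (quotientParts r a) = (Finset.univ.filter fun i => a i ≠ 0).card := by
  have := sum_quotientParts hr a fun _ _ => 1
  simpa [len] using this

theorem mem_orbitExponents_quotientParts (hr : 0 < r) (a : Fin n → ℕ) {A : Finset (Fin n)}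
    (hA : ∀ i ∈ A, a i = 0) (hc : A.card = ∑ i, a i / r) :
    (fun i => if i ∈ A then (0, 1, 0) else (a i / r, 0, a i % r)) ∈
      orbitExponents n (toTri (quotientParts r a)) := by
  set e : Fin n → ℕ × ℕ × ℕ :=
    fun i => if i ∈ A then (0, 1, 0) else (a i / r, 0, a i % r) with he
  have hd : Disjoint (Finset.univ.filter fun i => a i ≠ 0) A := by
    rw [Finset.disjoint_right]
    intro i hi
    simp [hA i hi]
  have hu : (Finset.univ.filter fun i => e i ≠ 0) =
      (Finset.univ.filter fun i => a i ≠ 0).disjUnion A hd := by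
    ext i
    rw [Finset.mem_disjUnion, Finset.mem_filter, Finset.mem_filter]
    by_cases hi : i ∈ A
    · simp [he, hi]
    · have h2 := Nat.mod_add_div (a i) r
      simp only [he, hi, if_false, Finset.mem_univ, true_and, or_false, Ne, Prod.mk_eq_zero,
        not_iff_not]
      constructor
      · rintro ⟨h1, h3⟩
        rw [h1, h3] at h2
        simpa using h2.symm
      · intro h
        simp [h]
  have hS : (Finset.univ.filter fun i => a i ≠ 0).val.map e =
      ∑ j : Fin r, (quotientParts r a j).map fun p => (p, 0, (j : ℕ)) := by
    have h1 := sum_quotientParts hr a fun p j => ({(p, 0, j)} : Multiset (ℕ × ℕ × ℕ))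
    have h2 : ∀ j : Fin r, ((quotientParts r a j).map fun p =>
        ({(p, 0, (j : ℕ))} : Multiset (ℕ × ℕ × ℕ))).sum =
        (quotientParts r a j).map fun p => (p, 0, (j : ℕ)) := fun j => by
      rw [← Multiset.sum_map_singleton ((quotientParts r a j).map fun p => (p, 0, (j : ℕ))),
        Multiset.map_map]
      rfl
    rw [Finset.sum_congr rfl fun j _ => h2 j] at h1
    rw [h1, ← Multiset.sum_map_singleton (Multiset.map e _), Multiset.map_map]
    refine Finset.sum_congr rfl fun i hi => ?_
    have hiA : i ∉ A := fun h => (Finset.mem_filter.1 hi).2 (hA i h)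
    simp [he, hiA]
  have hA' : A.val.map e = Multiset.replicate (∑ i, a i / r) (0, 1, 0) := by
    rw [← hc, Finset.card_def, ← Multiset.map_const']
    exact Multiset.map_congr rfl fun i hi => if_pos hi
  have hf : (Finset.univ.val.map e).filter (fun v => v ≠ 0) =
      (Finset.univ.filter fun i => e i ≠ 0).val.map e := by
    rw [Multiset.filter_map]
    rfl
  rw [mem_orbitExponents, hf, hu, Finset.disjUnion_val, Multiset.map_add, hS, hA', toTri,
    size_quotientParts hr]

variable [Fintype (Wreath r n)]

/-- All monomials of `m_Λ` are conjugate under `S_n`, so the orbit sum of `m_Λ` is a positive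
multiple of that of any one of them; it is also `|G_n|` times `m_Λ`. -/
theorem orbitSumBar_mem_span_monoSymmBar {Λ : Multiset (ℕ × ℕ × ℕ)} {e : Fin n → ℕ × ℕ × ℕ}
    (he : e ∈ orbitExponents n Λ) :
    orbitSumBar r n (mon (triExponents r e)) ∈ Submodule.span ℂ {monoSymmBar r n Λ} := by
  have h1 : orbitSumBar r n (triSubst r n (monoSymm n Λ)) =
      (Fintype.card (Wreath r n) : ℂ) • monoSymmBar r n Λ := by
    rw [orbitSumBar_apply, orbitSum_coe ⟨_, triSubst_monoSymm_mem r n Λ⟩, ← Ideal.Quotient.mkₐ_eq_mk ℂ,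
      map_smul]
    rfl
  have h2 : ∀ e' ∈ orbitExponents n Λ, orbitSumBar r n (mon (triExponents r e')) =
      orbitSumBar r n (mon (triExponents r e)) := by
    intro e' he'
    obtain ⟨σ, rfl⟩ := exists_perm_of_mem_orbitExponents he he'
    exact orbitSumBar_mon_comp σ (triExponents r e)
  rw [triSubst_monoSymm_eq_sum_mon, map_sum, Finset.sum_congr rfl h2, Finset.sum_const,
    ← Nat.cast_smul_eq_nsmul ℂ] at h1
  have h3 : ((orbitExponents n Λ).card : ℂ) ≠ 0 :=
    Nat.cast_ne_zero.2 (Finset.card_ne_zero_of_mem he)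
  rw [← Submodule.smul_mem_iff _ h3, h1]
  exact Submodule.smul_mem _ _ (Submodule.mem_span_singleton_self _)

variable (r n) in
/-- The span of the `m_Λ` in the statement of the theorem. -/
noncomputable def basisSpan : Submodule ℂ (FixedRing r n) :=
  Submodule.span ℂ (Set.range fun lam : Index r n => monoSymmBar r n (toTri lam.1))

/-- Each term puts `|λ|` factors `y` on distinct planes outside the `l(λ)` occupied ones, for `λ`
the `quotientParts` of `a`. The existence of a term is exactly what gives `|λ| + l(λ) ≤ n`. -/
theorem orbitSumBar_mul_elemY_mem (hr : 0 < r) (a : Fin n → ℕ) :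
    orbitSumBar r n (mon (withY r a 0) * elemY r (Finset.univ.filter fun i => a i ≠ 0)ᶜ
      (∑ i, a i / r)) ∈ basisSpan r n := by
  rw [elemY, Finset.mul_sum, map_sum]
  refine Submodule.sum_mem _ fun A hA => ?_
  obtain ⟨hAS, hAc⟩ := Finset.mem_powersetCard.1 hA
  have hA0 : ∀ i ∈ A, a i = 0 := fun i hi => by simpa using hAS hi
  let e : Fin n → ℕ × ℕ × ℕ := fun i => if i ∈ A then (0, 1, 0) else (a i / r, 0, a i % r)
  have hmon : mon (withY r a 0) * ∏ i ∈ A, X (Sum.inr i) ^ r = mon (triExponents r e) := by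
    rw [← Fintype.prod_ite_mem, mon, mon, ← Finset.prod_mul_distrib]
    refine Finset.prod_congr rfl fun i _ => ?_
    by_cases hi : i ∈ A
    · simp [withY, triExponents, e, hi, hA0 i hi]
    · simp [withY, triExponents, e, hi, Nat.div_add_mod]
  have he : e ∈ orbitExponents n (toTri (quotientParts r a)) :=
    mem_orbitExponents_quotientParts hr a hA0 hAc
  have hidx : (∀ i : Fin r, (i : ℕ) = 0 → 0 ∉ quotientParts r a i) ∧
      size (quotientParts r a) + len (quotientParts r a) ≤ n := by
    constructor
    · intro j hj h0
      obtain ⟨i, hi, hi2⟩ := Multiset.mem_map.1 h0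
      have h1 := (Finset.mem_filter.1 (Finset.mem_def.2 hi)).2
      have h2 := Nat.mod_add_div (a i) r
      rw [hi2, h1.2, hj] at h2
      exact h1.1 (by simpa using h2.symm)
    · rw [size_quotientParts hr, len_quotientParts hr, ← hAc]
      have h1 := Finset.card_le_card hAS
      rw [Finset.card_compl, Fintype.card_fin] at h1
      have h2 := Finset.card_le_univ (Finset.univ.filter fun i => a i ≠ 0)
      rw [Fintype.card_fin] at h2
      omega
  rw [hmon]
  refine Submodule.span_mono ?_ (orbitSumBar_mem_span_monoSymmBar he)
  rw [Set.singleton_subset_iff]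
  exact ⟨⟨_, hidx⟩, rfl⟩

theorem orbitSumBar_mon_mem (hr : 0 < r) : ∀ (l : ℕ) (e : Fin n → ℕ × ℕ), (places e).card = l →
    orbitSumBar r n (mon e) ∈ basisSpan r n := by
  intro l
  induction l using Nat.strong_induction_on with
  | _ l ih =>
    intro e he
    have hle : fewPlaces r n l ≤ basisSpan r n := by
      refine Submodule.span_le.2 ?_
      rintro _ ⟨e', he', rfl⟩
      exact ih _ he' e' rfl
    by_cases hb : ∀ i, (e i).1 = (e i).2
    · obtain ⟨a, rfl⟩ : ∃ a : Fin n → ℕ, e = fun i => (a i, a i) :=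
        ⟨fun i => (e i).1, funext fun i => Prod.ext rfl (hb i).symm⟩
      have h1 := straighten hr a (Finset.univ.filter fun i => a i ≠ 0)
        (fun i hi => (Finset.mem_filter.1 hi).2) (∑ i, a i / r) 0 (fun _ _ => rfl) (by simp)
      rw [if_pos ⟨fun i => Nat.zero_le _, fun i hi => by
        have : a i = 0 := by simpa using hi
        simp [this]⟩, he] at h1
      have h2 := (Submodule.sub_mem_iff_right _ (orbitSumBar_mul_elemY_mem hr a)).1 (hle h1)
      exact (Submodule.smul_mem_iff _ (pow_ne_zero _ (by norm_num))).1 h2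
    · obtain ⟨i, hi⟩ := not_forall.1 hb
      exact hle (he ▸ orbitSumBar_mem_of_unbalanced hr hi)

theorem basisSpan_eq_top (hr : 0 < r) : basisSpan r n = ⊤ := by
  rw [eq_top_iff, ← range_orbitSumBar, LinearMap.range_eq_map, ← span_range_mon, Submodule.map_span,
    Submodule.span_le]
  rintro _ ⟨_, ⟨e, rfl⟩, rfl⟩
  exact orbitSumBar_mon_mem hr _ e rfl

end Spanning

/-! ### Finiteness and the grading -/

theorem finite_index (r n : ℕ) : Finite (Index r n) := by
  -- Parts and multiplicities are both at most `n`, so a table of multiplicities determines `λ`.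
  let f : Index r n → Fin r → Fin (n + 1) → Fin (n + 1) := fun lam i p =>
    ⟨(lam.1 i).count (p : ℕ), Nat.lt_succ_of_le <| (Multiset.count_le_card _ _).trans <|
      (Finset.single_le_sum (f := fun i => (lam.1 i).card) (fun _ _ => Nat.zero_le _)
        (Finset.mem_univ i)).trans <| (Nat.le_add_left _ _).trans lam.2.2⟩
  refine Finite.of_injective f fun lam mu h => Subtype.ext (funext fun i => ?_)
  have hle : ∀ (nu : Index r n) (p : ℕ), p ∈ nu.1 i → p < n + 1 := fun nu p hp =>
    Nat.lt_succ_of_le <| (Multiset.single_le_sum (fun _ _ => Nat.zero_le _) p hp).trans <|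
      (Finset.single_le_sum (f := fun i => (nu.1 i).sum) (fun _ _ => Nat.zero_le _)
        (Finset.mem_univ i)).trans <| (Nat.le_add_right _ _).trans nu.2.2
  ext p
  by_cases hp : p < n + 1
  · exact congrArg Fin.val (congrFun (congrFun h i) ⟨p, hp⟩)
  · rw [Multiset.count_eq_zero_of_notMem fun h => hp (hle lam p h),
      Multiset.count_eq_zero_of_notMem fun h => hp (hle mu p h)]

theorem finite_wreath {r : ℕ} (hr : 0 < r) (n : ℕ) : Finite (Wreath r n) := by
  have : NeZero r := ⟨hr.ne'⟩
  exact Finite.of_equiv _ SemidirectProduct.equivProd.symm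

theorem sum_degree_toTri {r : ℕ} (lam : Fin r → Multiset ℕ) :
    ((toTri lam).map fun a => r * a.1 + a.2.2 + (r * a.2.1 + a.2.2)).sum = 2 * halfDegree lam := by
  have h : ∀ s : Multiset ℕ, (s.map fun x => r * x).sum = r * s.sum := fun s => by
    rw [Multiset.sum_map_mul_left, Multiset.map_id']
  rw [toTri_eq, Multiset.map_add, Multiset.sum_add, Multiset.map_map, Function.comp_def,
    sum_map_pairs]
  simp only [mul_zero, zero_add, Multiset.map_replicate, Multiset.sum_replicate, mul_one, add_zero,
    smul_eq_mul, halfDegree, size, Finset.mul_sum, Finset.sum_mul, ← Finset.sum_add_distrib,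
    Multiset.sum_map_add, h, Multiset.map_const',
    Multiset.sum_replicate]
  exact Finset.sum_congr rfl fun i _ => by ring

theorem monoSymmBar_mem_gradedPart (r n : ℕ) (lam : Fin r → Multiset ℕ) :
    monoSymmBar r n (toTri lam) ∈ gradedPart r n (2 * halfDegree lam) := by
  intro s
  have h : scale n s s (triSubst r n (monoSymm n (toTri lam))) =
      (s : ℂ) ^ (2 * halfDegree lam) • triSubst r n (monoSymm n (toTri lam)) := by
    rw [triSubst_monoSymm_eq_sum_mon, map_sum, Finset.smul_sum]
    refine Finset.sum_congr rfl fun e he => ?_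
    rw [scale_mon, ← sum_degree_toTri, ← sum_of_mem_orbitExponents he _ (by simp),
      ← Finset.prod_pow_eq_pow_sum]
    simp only [pow_add, triExponents]
  have h2 : conicalAct r n s ⟨_, triSubst_monoSymm_mem r n (toTri lam)⟩ =
      (s : ℂ) ^ (2 * halfDegree lam) • ⟨_, triSubst_monoSymm_mem r n (toTri lam)⟩ :=
    Subtype.ext h
  change Ideal.Quotient.mkₐ ℂ (fixedIdeal r n) (conicalAct r n s _) = _
  rw [h2, map_smul]
  rfl

set_option synthInstance.maxHeartbeats 400000 in
theorem iSupIndep_gradedPart (r n : ℕ) : iSupIndep (gradedPart r n) := by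
  have h1 := (Module.End.eigenspaces_iSupIndep
    (conicalActFixed r n (Units.mk0 2 two_ne_zero)).toLinearMap).comp
    (f := fun k : ℕ => (2 : ℂ) ^ k)
    (fun a b h => Nat.pow_right_injective le_rfl (by
      have h' : (2 : ℂ) ^ a = 2 ^ b := h
      exact_mod_cast h'))
  refine h1.mono fun k x hx => ?_
  rw [Function.comp_apply, Module.End.mem_eigenspace_iff]
  exact hx _

/-- The single element `s = 2` already separates the degrees, since the powers of `2` are distinct.
-/
theorem gradedPart_eq_span {r n : ℕ} {ι : Type*} (b : Module.Basis ι ℂ (FixedRing r n)) (d : ι → ℕ)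
    (hd : ∀ i, b i ∈ gradedPart r n (d i)) (k : ℕ) :
    gradedPart r n k = Submodule.span ℂ (b '' {i | d i = k}) := by
  apply le_antisymm
  · intro x hx
    rw [Module.Basis.mem_span_image]
    intro i hi
    let s : ℂˣ := Units.mk0 2 two_ne_zero
    have h1 : (b.coord i) ∘ₗ (conicalActFixed r n s).toLinearMap = (2 : ℂ) ^ d i • b.coord i := by
      refine b.ext fun j => ?_
      have h2 : conicalActFixed r n s (b j) = (2 : ℂ) ^ d j • b j := hd j s
      rw [LinearMap.comp_apply, AlgHom.toLinearMap_apply, h2, map_smul, LinearMap.smul_apply]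
      by_cases hij : j = i
      · rw [hij]
      · simp [hij]
    have h2 : conicalActFixed r n s x = (2 : ℂ) ^ k • x := hx s
    have h3 := LinearMap.congr_fun h1 x
    rw [LinearMap.comp_apply, AlgHom.toLinearMap_apply, h2, map_smul, LinearMap.smul_apply,
      smul_eq_mul, smul_eq_mul] at h3
    have h4 := mul_right_cancel₀ (Finsupp.mem_support_iff.1 hi) h3
    exact (Nat.pow_right_injective le_rfl (by exact_mod_cast h4)).symm
  · rw [Submodule.span_le]
    rintro _ ⟨i, rfl, rfl⟩
    exact hd i

end WreathFixed

theorem theorem3 (r n : ℕ) (hr : 0 < r) :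
    (∃ b : Module.Basis (WreathFixed.Index r n) ℂ (WreathFixed.FixedRing r n),
      ∀ lam : WreathFixed.Index r n,
        b lam = WreathFixed.monoSymmBar r n (WreathFixed.toTri lam.1) ∧
        b lam ∈ WreathFixed.gradedPart r n (2 * WreathFixed.halfDegree lam.1)) ∧
    Module.Finite ℂ (WreathFixed.FixedRing r n) ∧
    DirectSum.IsInternal (WreathFixed.gradedPart r n) ∧
    (∀ k : ℕ, Module.finrank ℂ (WreathFixed.gradedPart r n (2 * k)) =
      Nat.card {lam : WreathFixed.Index r n // WreathFixed.halfDegree lam.1 = k}) ∧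
    (∀ k : ℕ, Odd k → WreathFixed.gradedPart r n k = ⊥) := by
  classical
  have := WreathFixed.finite_index r n
  have := WreathFixed.finite_wreath hr n
  have := Fintype.ofFinite (WreathFixed.Wreath r n)
  let b := Module.Basis.mk (WreathFixed.linearIndependent_monoSymmBar (n := n) hr)
    (WreathFixed.basisSpan_eq_top hr).ge
  have hb : ∀ lam, b lam = WreathFixed.monoSymmBar r n (WreathFixed.toTri lam.1) := fun lam =>
    Module.Basis.mk_apply _ _ _
  have hdeg : ∀ lam, b lam ∈ WreathFixed.gradedPart r n (2 * WreathFixed.halfDegree lam.1) :=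
    fun lam => hb lam ▸ WreathFixed.monoSymmBar_mem_gradedPart r n lam.1
  have hspan := WreathFixed.gradedPart_eq_span b (fun lam => 2 * WreathFixed.halfDegree lam.1) hdeg
  refine ⟨⟨b, fun lam => ⟨hb lam, hdeg lam⟩⟩, Module.Finite.of_basis b, ?_, fun k => ?_,
    fun k hk => ?_⟩
  · rw [DirectSum.isInternal_submodule_iff_iSupIndep_and_iSup_eq_top]
    refine ⟨WreathFixed.iSupIndep_gradedPart r n, eq_top_iff.2 ?_⟩
    rw [← b.span_eq, Submodule.span_le]
    rintro _ ⟨lam, rfl⟩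
    exact Submodule.mem_iSup_of_mem _ (hdeg lam)
  · have := Fintype.ofFinite (WreathFixed.Index r n)
    have hli : LinearIndependent ℂ fun i : {lam : WreathFixed.Index r n //
        WreathFixed.halfDegree lam.1 = k} => b i.1 :=
      b.linearIndependent.comp _ Subtype.val_injective
    have hset : b '' {lam | 2 * WreathFixed.halfDegree lam.1 = 2 * k} =
        Set.range fun i : {lam : WreathFixed.Index r n // WreathFixed.halfDegree lam.1 = k} =>
          b i.1 := by
      ext x
      simp
    rw [hspan, hset, finrank_span_eq_card hli, Nat.card_eq_fintype_card]
  · rw [hspan, Submodule.span_eq_bot]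
    rintro _ ⟨lam, hlam, rfl⟩
    rw [← hlam] at hk
    exact absurd (even_two_mul _) (Nat.not_even_iff_odd.2 hk)
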